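/- Let $\mathbb K$ be an algebraically closed field of characteristic zero and let $\omega\in\mathbb R^N$ have rationally independent coordinates. Let $S_\omega$ be the field of $\omega$-positive Puiseux series, that is, of formal series $\varphi=\sum_{\alpha}c_\alpha x^\alpha$ with $c_\alpha\in\mathbb K$ whose set of exponents $\mathcal E(\varphi)=\{\alpha\in\mathbb Q^N\mid c_\alpha\ne0\}$ is contained in $\frac1k\mathbb Z^N$ for some integer $k\ge1$ and satisfies $\gamma+\mathcal E(\varphi)\subset\sigma$ for some $\gamma\in\mathbb Q^N$ and some convex rational polyhedral cone $\sigma\subset\mathbb R^N$ with $\omega\cdot v\ge0$ for all $v\in\sigma$. For $\varphi\neq 0$ in $S_\omega$ set $\operatorname{ord}_\omega\varphi=\min_{\alpha\in\mathcal E(\varphi)}\omega\cdot\alpha$, and let the first term of $\varphi$ be $\operatorname{in}_\omega\varphi=c_\alpha x^\alpha$, where $\alpha\in\mathcal E(\varphi)$ is the unique exponent with $\omega\cdot\alpha=\operatorname{ord}_\omega\varphi$; set $\operatorname{ord}_\omega 0=\infty$ and $\operatorname{in}_\omega 0=0$. For $M$-tuples of series, $\operatorname{ord}_\omega$ and $\operatorname{in}_\omega$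 are taken componentwise. Let $\eta\in(\mathbb R\cup\{\infty\})^M$, with the conventions $\infty\cdot0=0$ and $\infty\cdot a=\infty$ for $a>0$. For $f=\sum_\beta\phi_\beta y^\beta\in S_\omega[y]=S_\omega[y_1,\dots,y_M]$ let $\operatorname{ord}_{\omega,\eta}f=\min_{\phi_\beta\ne0}(\operatorname{ord}_\omega\phi_\beta+\eta\cdot\beta)$ (which is $\infty$ for $f=0$), and let the $\eta$-initial part of $f$ be $$\operatorname{in}_{\omega,\eta}f=\sum_{\operatorname{ord}_\omega\phi_\beta+\eta\cdot\beta=\operatorname{ord}_{\omega,\eta}f}(\operatorname{in}_\omega\phi_\beta)\,y^\beta$$ if $\operatorname{ord}_{\omega,\eta}f<\infty$, and $0$ otherwise. The $\eta$-initial ideal of an ideal $\mathfrak I\subset S_\omega[y]$ is the ideal of $S_\omega[y]$ generated by $\{\operatorname{in}_{\omega,\eta}f\mid f\in\mathfrak I\}\cup\{y_i\mid\eta_i=\infty\}$. Let $T_\eta\subset S_\omega^M$ be the set of all $\phi$ with $\phi_i\neq0$ whenever $\eta_i\ne\infty$ and $\phi_i=0$ whenever $\eta_i=\infty$. **Proposition.**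 Let $\mathfrak I\subset S_\omega[y]$ be an ideal with finitely many zeroes in $S_\omega^M$ and let $\eta\in(\mathbb R\cup\{\infty\})^M$. An element $\phi\in T_\eta$ is a zero of the $\eta$-initial ideal of $\mathfrak I$ if and only if $\operatorname{ord}_\omega\phi=\eta$ and there exists a zero $\varphi\in S_\omega^M$ of $\mathfrak I$ with $\operatorname{in}_\omega\varphi=\phi$. -/

import Mathlib

namespace OmegaPuiseux

noncomputable section

/-! ### Exponents -/

/-- The scalar product `ω · α` of a real vector `ω` and a rational exponent `α`. -/
def dot {N : ℕ} (ω : Fin N → ℝ) (α : Fin N → ℚ) : ℝ := ∑ i, ω i * (α i : ℝ)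

/-- The rational vector `α`, seen as a point of `ℝ^N`. -/
def toReal {N : ℕ} (α : Fin N → ℚ) : Fin N → ℝ := fun i => (α i : ℝ)

/-- The group of exponents `ℚ^N`, to be ordered by the vector `ω`. -/
def Expo {N : ℕ} (_ω : Fin N → ℝ) : Type := Fin N → ℚ

instance {N : ℕ} (ω : Fin N → ℝ) : AddCommGroup (Expo ω) :=
  inferInstanceAs (AddCommGroup (Fin N → ℚ))

theorem dot_add {N : ℕ} (ω : Fin N → ℝ) (α β : Fin N → ℚ) :
    dot ω (α + β) = dot ω α + dot ω β := by
  simp [dot, mul_add, Finset.sum_add_distrib]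

theorem dot_zero {N : ℕ} (ω : Fin N → ℝ) : dot ω 0 = 0 := by simp [dot]

theorem dot_neg {N : ℕ} (ω : Fin N → ℝ) (α : Fin N → ℚ) : dot ω (-α) = -dot ω α := by
  simp [dot]

/-- The order on `ℚ^N` induced by `ω`. When the coordinates of `ω` are rationally independent this
is the total order `α ≤ β ↔ ω · α ≤ ω · β`, see `Expo.le_iff_dot_le`. -/
instance {N : ℕ} (ω : Fin N → ℝ) : PartialOrder (Expo ω) where
  le α β := α = β ∨ dot ω α < dot ω β
  le_refl _ := Or.inl rfl
  le_trans α β γ := by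
    rintro (rfl | h) (rfl | h')
    · exact Or.inl rfl
    · exact Or.inr h'
    · exact Or.inr h
    · exact Or.inr (h.trans h')
  le_antisymm α β := by
    rintro (rfl | h) (h' | h')
    · rfl
    · rfl
    · exact h'.symm
    · exact absurd (h.trans h') (lt_irrefl _)

theorem Expo.le_def {N : ℕ} {ω : Fin N → ℝ} (α β : Expo ω) :
    α ≤ β ↔ α = β ∨ dot ω α < dot ω β := Iff.rfl

instance {N : ℕ} (ω : Fin N → ℝ) : IsOrderedCancelAddMonoid (Expo ω) where
  add_le_add_left α β h γ := by
    rcases h with rfl | h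
    · exact le_rfl
    · refine Or.inr ?_
      have h1 := dot_add ω α γ
      have h2 := dot_add ω β γ
      change dot ω (Add.add (α : Fin N → ℚ) γ) < dot ω (Add.add (β : Fin N → ℚ) γ)
      change dot ω (Add.add (α : Fin N → ℚ) γ) = _ at h1
      change dot ω (Add.add (β : Fin N → ℚ) γ) = _ at h2
      linarith
  le_of_add_le_add_left α β γ h := by
    rcases h with h | h
    · exact Or.inl (add_left_cancel h)
    · refine Or.inr ?_
      have h1 := dot_add ω α β
      have h2 := dot_add ω α γ
      change dot ω (Add.add (α : Fin N → ℚ) β) < dot ω (Add.add (α : Fin N → ℚ) γ) at h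
      change dot ω (Add.add (α : Fin N → ℚ) β) = _ at h1
      change dot ω (Add.add (α : Fin N → ℚ) γ) = _ at h2
      linarith

theorem dot_injective {N : ℕ} {ω : Fin N → ℝ} (hω : LinearIndependent ℚ ω) :
    Function.Injective (dot ω) := by
  intro α β h
  have h0 : ∑ i, (α i - β i) • ω i = 0 := by
    have : ∑ i, (α i - β i) • ω i = dot ω α - dot ω β := by
      rw [dot, dot, ← Finset.sum_sub_distrib]
      refine Finset.sum_congr rfl fun i _ => ?_
      rw [Rat.smul_def]
      push_cast
      ring
    rw [this, h, sub_self]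
  funext i
  exact sub_eq_zero.mp (Fintype.linearIndependent_iff.mp hω _ h0 i)

theorem Expo.le_iff_dot_le {N : ℕ} {ω : Fin N → ℝ} (hω : LinearIndependent ℚ ω) (α β : Expo ω) :
    α ≤ β ↔ dot ω α ≤ dot ω β := by
  rw [Expo.le_def]
  constructor
  · rintro (rfl | h)
    · exact le_rfl
    · exact h.le
  · intro h
    rcases h.eq_or_lt with h | h
    · exact Or.inl (dot_injective hω h)
    · exact Or.inr h

/-! ### `ω`-positive Puiseux series -/

/-- `σ` is a convex rational polyhedral cone: the set of non-negative real combinations of finitely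
many vectors of `ℚ^N`. -/
def IsRationalCone {N : ℕ} (σ : PointedCone ℝ (Fin N → ℝ)) : Prop :=
  ∃ s : Finset (Fin N → ℚ), σ = PointedCone.hull ℝ (toReal '' (s : Set (Fin N → ℚ)))

/-- `σ` is `ω`-positive: `v · ω ≥ 0` for all `v ∈ σ`. -/
def IsPositiveCone {N : ℕ} (ω : Fin N → ℝ) (σ : PointedCone ℝ (Fin N → ℝ)) : Prop :=
  ∀ v ∈ σ, 0 ≤ ∑ i, ω i * v i

/-- The set of exponents `E` is contained in a lattice `(1/k) ℤ^N`. -/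
def InLattice {N : ℕ} (E : Set (Fin N → ℚ)) : Prop :=
  ∃ k : ℕ, 0 < k ∧ ∀ α ∈ E, ∀ i, ∃ m : ℤ, α i = (m : ℚ) / (k : ℚ)

/-- Some rational translate of the set of exponents `E` is contained in an `ω`-positive convex
rational polyhedral cone. -/
def InPositiveCone {N : ℕ} (ω : Fin N → ℝ) (E : Set (Fin N → ℚ)) : Prop :=
  ∃ (γ : Fin N → ℚ) (σ : PointedCone ℝ (Fin N → ℝ)), IsRationalCone σ ∧ IsPositiveCone ω σ ∧
    ∀ α ∈ E, toReal (α + γ) ∈ σ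

/-- `E` may be the set of exponents of an `ω`-positive Puiseux series. -/
def Admissible {N : ℕ} (ω : Fin N → ℝ) (E : Set (Fin N → ℚ)) : Prop :=
  InLattice E ∧ InPositiveCone ω E

theorem toReal_add {N : ℕ} (α β : Fin N → ℚ) : toReal (α + β) = toReal α + toReal β := by
  funext i; simp [toReal]

theorem Admissible.mono {N : ℕ} {ω : Fin N → ℝ} {E F : Set (Fin N → ℚ)} (h : E ⊆ F)
    (hF : Admissible ω F) : Admissible ω E := by
  obtain ⟨⟨k, hk, hl⟩, γ, σ, h1, h2, h3⟩ := hF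
  exact ⟨⟨k, hk, fun α hα => hl α (h hα)⟩, γ, σ, h1, h2, fun α hα => h3 α (h hα)⟩

theorem isRationalCone_hull {N : ℕ} (s : Finset (Fin N → ℚ)) :
    IsRationalCone (PointedCone.hull ℝ (toReal '' (s : Set (Fin N → ℚ)))) := ⟨s, rfl⟩

theorem IsRationalCone.sup {N : ℕ} {σ τ : PointedCone ℝ (Fin N → ℝ)} (hσ : IsRationalCone σ)
    (hτ : IsRationalCone τ) : IsRationalCone (σ ⊔ τ) := by
  classical
  obtain ⟨s, rfl⟩ := hσ
  obtain ⟨t, rfl⟩ := hτ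
  refine ⟨s ∪ t, ?_⟩
  rw [Finset.coe_union, Set.image_union]
  exact (Submodule.span_union _ _).symm

theorem IsPositiveCone.sup {N : ℕ} {ω : Fin N → ℝ} {σ τ : PointedCone ℝ (Fin N → ℝ)}
    (hσ : IsPositiveCone ω σ) (hτ : IsPositiveCone ω τ) : IsPositiveCone ω (σ ⊔ τ) := by
  intro v hv
  obtain ⟨a, ha, b, hb, rfl⟩ := Submodule.mem_sup.mp hv
  have := add_nonneg (hσ a ha) (hτ b hb)
  simpa [mul_add, Finset.sum_add_distrib] using this

theorem isPositiveCone_hull {N : ℕ} {ω : Fin N → ℝ} {s : Finset (Fin N → ℚ)}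
    (h : ∀ v ∈ s, 0 ≤ dot ω v) :
    IsPositiveCone ω (PointedCone.hull ℝ (toReal '' (s : Set (Fin N → ℚ)))) := by
  intro v hv
  induction hv using Submodule.span_induction with
  | mem x hx =>
    obtain ⟨v, hv, rfl⟩ := hx
    exact h v hv
  | zero => simp
  | add x y _ _ hx hy => simpa [mul_add, Finset.sum_add_distrib] using add_nonneg hx hy
  | smul a x _ hx =>
    have : ∑ i, ω i * (a • x) i = (a : ℝ) * ∑ i, ω i * x i := by
      rw [Finset.mul_sum]
      refine Finset.sum_congr rfl fun i _ => ?_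
      change ω i * ((a : ℝ) * x i) = _
      ring
    rw [this]
    exact mul_nonneg a.2 hx

theorem admissible_singleton {N : ℕ} (ω : Fin N → ℝ) (α : Fin N → ℚ) : Admissible ω {α} := by
  constructor
  · refine ⟨∏ i, (α i).den, Finset.prod_pos fun i _ => (α i).den_pos, ?_⟩
    intro β hβ i
    rw [Set.mem_singleton_iff.mp hβ]
    obtain ⟨c, hc⟩ := Finset.dvd_prod_of_mem (fun i => (α i).den) (Finset.mem_univ i)
    have hd : ((∏ i, (α i).den : ℕ) : ℚ) ≠ 0 := by
      exact_mod_cast (Finset.prod_pos fun i _ => (α i).den_pos).ne'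
    refine ⟨(α i).num * c, ?_⟩
    rw [eq_div_iff hd, hc]
    have := Rat.mul_den_eq_num (α i)
    push_cast
    rw [← this]
    ring
  · refine ⟨-α, ⊥, ⟨∅, by simp⟩, ?_, ?_⟩
    · intro v hv
      rw [Submodule.mem_bot] at hv
      simp [hv]
    · intro β hβ
      rw [Set.mem_singleton_iff.mp hβ, Submodule.mem_bot]
      funext i
      simp [toReal]

theorem InLattice.common {N : ℕ} {E F : Set (Fin N → ℚ)} (hE : InLattice E) (hF : InLattice F) :
    ∃ k : ℕ, 0 < k ∧ (∀ α ∈ E, ∀ i, ∃ m : ℤ, α i = (m : ℚ) / (k : ℚ)) ∧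
      ∀ α ∈ F, ∀ i, ∃ m : ℤ, α i = (m : ℚ) / (k : ℚ) := by
  obtain ⟨k, hk, h⟩ := hE
  obtain ⟨l, hl, h'⟩ := hF
  have hk' : (k : ℚ) ≠ 0 := by exact_mod_cast hk.ne'
  have hl' : (l : ℚ) ≠ 0 := by exact_mod_cast hl.ne'
  refine ⟨k * l, Nat.mul_pos hk hl, fun α hα i => ?_, fun α hα i => ?_⟩
  · obtain ⟨m, hm⟩ := h α hα i
    exact ⟨m * l, by rw [hm]; push_cast; field_simp⟩
  · obtain ⟨m, hm⟩ := h' α hα i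
    exact ⟨m * k, by rw [hm]; push_cast; field_simp⟩

theorem Admissible.union {N : ℕ} {ω : Fin N → ℝ} {E F : Set (Fin N → ℚ)} (hE : Admissible ω E)
    (hF : Admissible ω F) : Admissible ω (E ∪ F) := by
  constructor
  · obtain ⟨k, hk, h1, h2⟩ := hE.1.common hF.1
    exact ⟨k, hk, fun α hα => hα.elim (h1 α) (h2 α)⟩
  · obtain ⟨γ, σ, h1, h2, h3⟩ := hE.2
    obtain ⟨δ, τ, h1', h2', h3'⟩ := hF.2
    have key : ∀ {E F : Set (Fin N → ℚ)} {γ δ : Fin N → ℚ} {σ τ : PointedCone ℝ (Fin N → ℝ)},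
        IsRationalCone σ → IsPositiveCone ω σ → (∀ α ∈ E, toReal (α + γ) ∈ σ) →
        IsRationalCone τ → IsPositiveCone ω τ → (∀ α ∈ F, toReal (α + δ) ∈ τ) →
        dot ω δ ≤ dot ω γ → InPositiveCone ω (E ∪ F) := by
      intro E F γ δ σ τ h1 h2 h3 h1' h2' h3' h
      refine ⟨γ, (σ ⊔ τ) ⊔ PointedCone.hull ℝ (toReal '' ((({γ - δ} : Finset (Fin N → ℚ))) :
        Set (Fin N → ℚ))), (h1.sup h1').sup (isRationalCone_hull _), (h2.sup h2').sup
        (isPositiveCone_hull ?_), ?_⟩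
      · intro v hv
        rw [Finset.mem_singleton] at hv
        rw [hv, sub_eq_add_neg, dot_add, dot_neg]
        linarith
      · rintro α (hα | hα)
        · exact Submodule.mem_sup_left (Submodule.mem_sup_left (h3 α hα))
        · have : α + γ = (α + δ) + (γ - δ) := by abel
          rw [this, toReal_add]
          refine Submodule.add_mem _ (Submodule.mem_sup_left (Submodule.mem_sup_right (h3' α hα)))
            (Submodule.mem_sup_right (Submodule.subset_span ⟨γ - δ, by simp, rfl⟩))
    rcases le_total (dot ω δ) (dot ω γ) with h | h
    · exact key h1 h2 h3 h1' h2' h3' h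
    · rw [Set.union_comm]
      exact key h1' h2' h3' h1 h2 h3 h

theorem Admissible.add {N : ℕ} {ω : Fin N → ℝ} {E F G : Set (Fin N → ℚ)} (hE : Admissible ω E)
    (hF : Admissible ω F) (hG : ∀ g ∈ G, ∃ e ∈ E, ∃ f ∈ F, e + f = g) : Admissible ω G := by
  constructor
  · obtain ⟨k, hk, h1, h2⟩ := hE.1.common hF.1
    refine ⟨k, hk, fun α hα i => ?_⟩
    obtain ⟨e, he, f, hf, rfl⟩ := hG α hα
    obtain ⟨m, hm⟩ := h1 e he i
    obtain ⟨n, hn⟩ := h2 f hf i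
    exact ⟨m + n, by rw [Pi.add_apply, hm, hn]; push_cast; ring⟩
  · obtain ⟨γ, σ, h1, h2, h3⟩ := hE.2
    obtain ⟨δ, τ, h1', h2', h3'⟩ := hF.2
    refine ⟨γ + δ, σ ⊔ τ, h1.sup h1', h2.sup h2', fun α hα => ?_⟩
    obtain ⟨e, he, f, hf, rfl⟩ := hG α hα
    have : e + f + (γ + δ) = (e + γ) + (f + δ) := by abel
    rw [this, toReal_add]
    exact Submodule.add_mem_sup (h3 e he) (h3' f hf)

/-- Over an admissible set `E`, only finitely many `α ∈ E` satisfy `ω · α ≤ c`. -/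
theorem Admissible.finite_le {N : ℕ} {ω : Fin N → ℝ} (hω : LinearIndependent ℚ ω)
    {E : Set (Fin N → ℚ)} (hE : Admissible ω E) (c : ℝ) : {α ∈ E | dot ω α ≤ c}.Finite := by
  obtain ⟨⟨k, hk, hl⟩, γ, σ, ⟨s, rfl⟩, h2, h3⟩ := hE
  have hs : ∀ v ∈ s, 0 ≤ dot ω v := fun v hv => h2 _ (Submodule.subset_span ⟨v, hv, rfl⟩)
  set C : ℝ := c + dot ω γ with hC
  let B : Fin N → ℝ := fun i => ∑ v ∈ s, C / dot ω v * |(v i : ℝ)| + |(γ i : ℝ)|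
  have hbound : ∀ α ∈ {α ∈ E | dot ω α ≤ c}, ∀ i, |(α i : ℝ)| ≤ B i := by
    rintro α ⟨hα, hc⟩ i
    obtain ⟨a, ha⟩ := (Submodule.mem_span_image_finset_iff_exists_fun' _).mp (h3 α hα)
    have hcoord : ∀ j, ((α + γ) j : ℝ) = ∑ v ∈ s, (a v : ℝ) * (v j : ℝ) := by
      intro j
      have := congrFun ha j
      rw [Finset.sum_apply] at this
      exact this.symm
    have hdot : ∑ v ∈ s, (a v : ℝ) * dot ω v ≤ C := by
      have : dot ω (α + γ) = ∑ v ∈ s, (a v : ℝ) * dot ω v := by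
        simp only [dot, hcoord, Finset.mul_sum]
        rw [Finset.sum_comm]
        exact Finset.sum_congr rfl fun v _ => Finset.sum_congr rfl fun j _ => by ring
      rw [← this, dot_add, hC]
      linarith
    have hterm : ∀ v ∈ s, (a v : ℝ) * |(v i : ℝ)| ≤ C / dot ω v * |(v i : ℝ)| := by
      intro v hv
      by_cases hv0 : v = 0
      · simp [hv0]
      · have hpos : 0 < dot ω v := lt_of_le_of_ne (hs v hv) fun h =>
          hv0 (dot_injective hω (h.symm.trans (dot_zero ω).symm))
        refine mul_le_mul_of_nonneg_right ?_ (abs_nonneg _)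
        rw [le_div_iff₀ hpos]
        exact (Finset.single_le_sum (f := fun v => (a v : ℝ) * dot ω v)
          (fun w hw => mul_nonneg (a w).2 (hs w hw)) hv).trans hdot
    have h4 : |((α + γ) i : ℝ)| ≤ ∑ v ∈ s, C / dot ω v * |(v i : ℝ)| := by
      rw [hcoord]
      refine (Finset.abs_sum_le_sum_abs _ _).trans (Finset.sum_le_sum fun v hv => ?_)
      rw [abs_mul, abs_of_nonneg (a v).2]
      exact hterm v hv
    have h5 : (α i : ℝ) = ((α + γ) i : ℝ) - γ i := by simp
    rw [h5]
    exact (abs_sub _ _).trans (add_le_add_left h4 _)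
  have hk' : (0 : ℝ) < k := by exact_mod_cast hk
  have hfin : (Set.univ.pi fun i : Fin N => Set.Icc (-⌈B i * k⌉) ⌈B i * k⌉).Finite :=
    Set.Finite.pi fun i => Set.finite_Icc _ _
  refine (hfin.image fun m : Fin N → ℤ => fun i => (m i : ℚ) / (k : ℚ)).subset ?_
  intro α hα
  choose m hm using hl α hα.1
  refine ⟨m, fun i _ => ?_, funext fun i => (hm i).symm⟩
  have h6 : |(m i : ℝ)| ≤ B i * k := by
    have h7 := hbound α hα i
    rw [hm i] at h7
    push_cast at h7
    rwa [abs_div, abs_of_pos hk', div_le_iff₀ hk'] at h7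
  obtain ⟨h8, h9⟩ := abs_le.mp h6
  have h10 := Int.le_ceil (B i * k)
  constructor
  · have : ((-⌈B i * k⌉ : ℤ) : ℝ) ≤ m i := by push_cast; linarith
    exact_mod_cast this
  · have : (m i : ℝ) ≤ (⌈B i * k⌉ : ℤ) := by linarith
    exact_mod_cast this

theorem Admissible.isPWO {N : ℕ} {ω : Fin N → ℝ} (hω : LinearIndependent ℚ ω)
    {E : Set (Expo ω)} (hE : Admissible ω E) : E.IsPWO := by
  intro f
  by_cases h : ∃ n, 0 < n ∧ (f 0 : Expo ω) ≤ f n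
  · obtain ⟨n, hn, h⟩ := h
    exact ⟨0, n, hn, h⟩
  · push Not at h
    have hfin := Admissible.finite_le hω hE (dot ω (f 0 : Expo ω))
    have hmem : ∀ n, (f n : Expo ω) ∈
        {α : Fin N → ℚ | α ∈ (E : Set (Fin N → ℚ)) ∧ dot ω α ≤ dot ω (f 0 : Expo ω)} := by
      intro n
      refine ⟨(f n).2, ?_⟩
      rcases Nat.eq_zero_or_pos n with rfl | hn
      · exact le_rfl
      · by_contra! hlt
        exact h n hn (Or.inr hlt)
    obtain ⟨m, n, hmn, heq⟩ := Set.Finite.exists_lt_map_eq_of_forall_mem hmem hfin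
    exact ⟨m, n, hmn, Or.inl heq⟩

open scoped Pointwise in
/-- The ring of `ω`-positive Puiseux series with coefficients in `K`, with the usual
sum and (convolution) product of series. The well-ordered support that is built into Hahn series is
no extra condition when the coordinates of `ω` are rationally independent, see
`Admissible.isPWO`. -/
def puiseux {N : ℕ} (ω : Fin N → ℝ) (K : Type*) [Field K] : Subring (HahnSeries (Expo ω) K) where
  carrier := {φ | Admissible ω φ.support}
  mul_mem' {a b} ha hb := by
    classical
    refine Admissible.add ha hb fun g hg => ?_
    have hg' : (g : Expo ω) ∈ a.support + b.support :=
      HahnSeries.support_mul_subset (Γ := Expo ω) (x := a) (y := b) hg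
    obtain ⟨e, he, f, hf, h⟩ := Set.mem_add.mp hg'
    exact ⟨e, he, f, hf, h⟩
  one_mem' :=
    (admissible_singleton ω 0).mono
      (HahnSeries.support_single_subset (Γ := Expo ω) (R := K) (a := 0) (r := 1))
  add_mem' {a b} ha hb := (Admissible.union ha hb).mono (HahnSeries.support_add_subset a b)
  zero_mem' := by
    refine (admissible_singleton ω 0).mono ?_
    intro α hα
    exact absurd rfl hα
  neg_mem' {a} ha := by
    change Admissible ω (-a).support
    rw [HahnSeries.support_neg]
    exact ha

/-- The field `S_ω` of `ω`-positive Puiseux series. -/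
abbrev S {N : ℕ} (ω : Fin N → ℝ) (K : Type*) [Field K] : Type _ := puiseux ω K

/-- The monomial `c x^α`. -/
def monomialSeries {N : ℕ} (ω : Fin N → ℝ) {K : Type*} [Field K] (α : Expo ω) (c : K) : S ω K :=
  ⟨HahnSeries.single α c,
    Admissible.mono (HahnSeries.support_single_subset (Γ := Expo ω) (a := α) (r := c))
      (admissible_singleton ω α)⟩

/-- The order `ord_ω φ` of a series: the least `ω · α` for `α` an exponent of `φ`
(see `ord_isLeast`), and `∞` for `φ = 0`. -/
def ord {N : ℕ} {ω : Fin N → ℝ} {K : Type*} [Field K] (φ : S ω K) : WithTop ℝ :=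
  (φ : HahnSeries (Expo ω) K).orderTop.map fun α : Expo ω => dot ω α

/-- The first term `c_α x^α` of a series, with `ω · α = ord_ω φ`; it is `0` for `φ = 0`. -/
def firstTerm {N : ℕ} {ω : Fin N → ℝ} {K : Type*} [Field K] (φ : S ω K) : S ω K :=
  monomialSeries ω (φ : HahnSeries (Expo ω) K).order
    ((φ : HahnSeries (Expo ω) K).coeff (φ : HahnSeries (Expo ω) K).order)

/-! ### Weighted orders, initial parts and initial ideals -/

/-- The weight `η · β` of the monomial `y^β`, with `0 · ∞ = 0` and `n · ∞ = ∞` for `n > 0`. -/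
def weight {M : ℕ} (η : Fin M → WithTop ℝ) (β : Fin M →₀ ℕ) : WithTop ℝ := ∑ i, β i • η i

/-- The `η`-order of a polynomial in `S_ω[y]` (it is `∞` for the polynomial `0`). -/
def polyOrd {N M : ℕ} {ω : Fin N → ℝ} {K : Type*} [Field K] (η : Fin M → WithTop ℝ)
    (f : MvPolynomial (Fin M) (S ω K)) : WithTop ℝ :=
  f.support.inf fun β => ord (f.coeff β) + weight η β

open Classical in
/-- The `η`-initial part of a polynomial in `S_ω[y]` (it is `0` if the `η`-order is `∞`). -/
def initPart {N M : ℕ} {ω : Fin N → ℝ} {K : Type*} [Field K] (η : Fin M → WithTop ℝ)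
    (f : MvPolynomial (Fin M) (S ω K)) : MvPolynomial (Fin M) (S ω K) :=
  if polyOrd η f = ⊤ then 0 else
    ∑ β ∈ f.support with ord (f.coeff β) + weight η β = polyOrd η f,
      MvPolynomial.monomial β (firstTerm (f.coeff β))

/-- The `η`-initial ideal of an ideal of `S_ω[y]`: it is generated by the `η`-initial parts of the
elements of the ideal and by the `y_i` with `η_i = ∞`. -/
def initIdeal {N M : ℕ} {ω : Fin N → ℝ} {K : Type*} [Field K] (η : Fin M → WithTop ℝ)
    (I : Ideal (MvPolynomial (Fin M) (S ω K))) : Ideal (MvPolynomial (Fin M) (S ω K)) :=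
  Ideal.span ({g | ∃ f ∈ I, g = initPart η f} ∪ {g | ∃ i, η i = ⊤ ∧ g = MvPolynomial.X i})

/-- The set of common zeroes in `S_ω^M` of an ideal of `S_ω[y]`. -/
def zeroes {N M : ℕ} {ω : Fin N → ℝ} {K : Type*} [Field K]
    (I : Ideal (MvPolynomial (Fin M) (S ω K))) : Set (Fin M → S ω K) :=
  {φ | ∀ f ∈ I, MvPolynomial.eval φ f = 0}

/-- The torus `T_η`: non-zero entries where `η_i` is finite, and zero entries where `η_i = ∞`. -/
def torus {N M : ℕ} (ω : Fin N → ℝ) (K : Type*) [Field K] (η : Fin M → WithTop ℝ) :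
    Set (Fin M → S ω K) :=
  {φ | (∀ i, η i ≠ ⊤ → φ i ≠ 0) ∧ ∀ i, η i = ⊤ → φ i = 0}

/-! ### Consistency of the definitions -/

theorem ord_isLeast {N : ℕ} {ω : Fin N → ℝ} {K : Type*} [Field K]
    (φ : S ω K) (hφ : φ ≠ 0) :
    ord φ = (dot ω (φ : HahnSeries (Expo ω) K).order : ℝ) ∧
      IsLeast (dot ω '' (φ : HahnSeries (Expo ω) K).support)
        (dot ω (φ : HahnSeries (Expo ω) K).order) := by
  have h0 : (φ : HahnSeries (Expo ω) K) ≠ 0 := fun h => hφ (Subtype.ext h)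
  refine ⟨?_, ⟨_, ?_, rfl⟩, ?_⟩
  · rw [ord, ← HahnSeries.order_eq_orderTop_of_ne_zero h0]
    rfl
  · exact fun h => h0 (HahnSeries.coeff_order_eq_zero.mp h)
  · rintro _ ⟨α, hα, rfl⟩
    rw [HahnSeries.order_of_ne h0]
    by_contra! hlt
    exact (φ : HahnSeries (Expo ω) K).isWF_support.not_lt_min
      (HahnSeries.support_nonempty_iff.2 h0) hα
      (lt_of_le_of_ne (Or.inr hlt) fun h => (h ▸ hlt).false)

theorem ord_zero {N : ℕ} {ω : Fin N → ℝ} {K : Type*} [Field K] : ord (0 : S ω K) = ⊤ := by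
  simp [ord]

end

end OmegaPuiseux

/-!
The field `S_ω` is algebraically closed. A monic irreducible `q` may be translated to have vanishing
next-to-leading coefficient. If `q ≠ y^n`, a scaling of the variable makes all exponents of `q`
non-negative with some lower coefficient of order zero; the exponents then lie in a well-ordered
monoid `P` of lattice points of a cone. Solving degree by degree in `P`, Hensel's lemma lifts a
coprime factorization of the residue polynomial in `K[y]`, so by irreducibility this residue is
`(y - a)^n`; it has no term in `y^(n-1)`, hence is `y^n`, contradicting the choice of the scaling.

The polynomials whose `η`-initial part does not vanish at `φ ∈ T_η` form a multiplicative set. If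
`ψ` does not satisfy `ord ψ = η` and `in ψ = φ`, some `y_i - ψ_i` belongs to it. If this is so for
each of the finitely many zeroes of `I`, then a product of such linear polynomials vanishes at all
of them, and by the Nullstellensatz over `S_ω` one of its powers lies in `I`; hence `φ` is no zero
of the initial ideal. Conversely, for a zero `ψ` of `I` with `ord ψ = η` and an `f ∈ I` of order
`p`, the value of the initial part of `f` at `in ψ` consists of the terms of order `p` of
`f(ψ) = 0`.
-/

namespace OmegaPuiseux

section Hensel

open Polynomial

theorem exists_fixedPoint_of_wellFounded {α β : Type*} [Nonempty β] {r : α → α → Prop}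
    (hr : WellFounded r) (Φ : (α → β) → α → β)
    (hΦ : ∀ x y a, (∀ b, r b a → x b = y b) → Φ x a = Φ y a) : ∃ x, Φ x = x := by
  classical
  let x : α → β := hr.fix fun a F =>
    Φ (fun b => if h : r b a then F b h else Classical.ofNonempty) a
  refine ⟨x, funext fun a => ?_⟩
  have hx : x a = Φ (fun b => if r b a then x b else Classical.ofNonempty) a := hr.fix_eq _ a
  rw [hx]
  exact hΦ _ _ a fun b hb => (if_pos hb).symm

section ofCoeffNeZero

variable {Q : Type*} [Zero Q] [PartialOrder Q] [WellQuasiOrderedLE Q]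

/-- The series `∑ a q x^q` over `q ≠ 0`. Over a well-quasi-ordered set of exponents every family
of coefficients is a series. -/
noncomputable def ofCoeffNeZero {R : Type*} [Zero R] (a : Q → R) : HahnSeries Q R :=
  open Classical in ⟨fun q => if q = 0 then 0 else a q, Set.isPWO_of_wellQuasiOrderedLE _⟩

theorem coeff_ofCoeffNeZero_zero {R : Type*} [Zero R] (a : Q → R) :
    (ofCoeffNeZero a).coeff 0 = 0 := if_pos rfl

theorem coeff_ofCoeffNeZero_of_ne {R : Type*} [Zero R] (a : Q → R) {q : Q} (hq : q ≠ 0) :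
    (ofCoeffNeZero a).coeff q = a q := if_neg hq

theorem coeff_ofCoeffNeZero_mem {R : Type*} [AddGroup R] {U : AddSubgroup R} (a : Q → U) (q : Q) :
    (ofCoeffNeZero fun i => (a i : R)).coeff q ∈ U := by
  rcases eq_or_ne q 0 with rfl | hq
  · rw [coeff_ofCoeffNeZero_zero]
    exact U.zero_mem
  · rw [coeff_ofCoeffNeZero_of_ne _ hq]
    exact (a q).2

end ofCoeffNeZero

variable {Q : Type*} [AddCommMonoid Q] [PartialOrder Q] [IsOrderedCancelAddMonoid Q]
  [WellQuasiOrderedLE Q]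

theorem coeff_mul_eq_sum_antidiagonal_univ {R : Type*} [NonUnitalNonAssocSemiring R]
    (a b : HahnSeries Q R) (q : Q) :
    (a * b).coeff q = ∑ ij ∈ Finset.antidiagonal (Set.isPWO_of_wellQuasiOrderedLE Set.univ)
      (Set.isPWO_of_wellQuasiOrderedLE Set.univ) q, a.coeff ij.1 * b.coeff ij.2 := by
  rw [HahnSeries.coeff_mul]
  refine Finset.sum_subset (fun ij h => ?_) fun ij h h' => ?_
  · simp_all [Finset.mem_antidiagonal]
  · by_contra hne
    exact h' <| Finset.mem_antidiagonal.mpr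
      ⟨left_ne_zero_of_mul hne, right_ne_zero_of_mul hne, (Finset.mem_antidiagonal.mp h).2.2⟩

theorem coeff_zero_mul (hQ : ∀ q : Q, 0 ≤ q) {R : Type*} [NonUnitalNonAssocSemiring R]
    (a b : HahnSeries Q R) : (a * b).coeff 0 = a.coeff 0 * b.coeff 0 := by
  rw [coeff_mul_eq_sum_antidiagonal_univ]
  refine Finset.sum_eq_single_of_mem (0, 0) (by simp [Finset.mem_antidiagonal]) fun ij h hne => ?_
  have hij := (add_eq_zero_iff_of_nonneg (hQ _) (hQ _)).mp (Finset.mem_antidiagonal.mp h).2.2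
  exact absurd (Prod.ext hij.1 hij.2) hne

theorem coeff_ofCoeffNeZero_mul_congr (hQ : ∀ q : Q, 0 ≤ q) {R : Type*}
    [NonUnitalNonAssocSemiring R] {a a' b b' : Q → R} {q : Q} (ha : ∀ i < q, a i = a' i)
    (hb : ∀ i < q, b i = b' i) :
    (ofCoeffNeZero a * ofCoeffNeZero b).coeff q =
      (ofCoeffNeZero a' * ofCoeffNeZero b').coeff q := by
  simp only [coeff_mul_eq_sum_antidiagonal_univ]
  refine Finset.sum_congr rfl fun ij hij => ?_
  obtain ⟨-, -, hadd⟩ := Finset.mem_antidiagonal.mp hij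
  rcases eq_or_ne ij.1 0 with hi | hi
  · simp only [hi, coeff_ofCoeffNeZero_zero, zero_mul]
  rcases eq_or_ne ij.2 0 with hj | hj
  · simp only [hj, coeff_ofCoeffNeZero_zero, mul_zero]
  have hiq : ij.1 < q := hadd ▸ lt_add_of_pos_right _ ((hQ _).lt_of_ne hj.symm)
  have hjq : ij.2 < q := hadd ▸ lt_add_of_pos_left _ ((hQ _).lt_of_ne hi.symm)
  simp only [coeff_ofCoeffNeZero_of_ne _ hi, coeff_ofCoeffNeZero_of_ne _ hj, ha _ hiq, hb _ hjq]

/-- In degree `q` the equation reads `A_q h + g B_q = E_q - ∑ A_i B_j`, where only `i, j < q` occur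
on the right, since `A` and `B` have no constant term: it is solved by recursion on `q`. -/
theorem exists_mul_C_add_C_mul_add_mul_eq (hQ : ∀ q : Q, 0 ≤ q) {R : Type*} [Ring R]
    {U V W : AddSubgroup R} {g h : R} (hUV : ∀ u ∈ U, ∀ v ∈ V, u * v ∈ W)
    (hW : ∀ w ∈ W, ∃ u ∈ U, ∃ v ∈ V, u * h + g * v = w) {E : HahnSeries Q R}
    (hE₀ : E.coeff 0 = 0) (hE : ∀ q, E.coeff q ∈ W) :
    ∃ A B : HahnSeries Q R, A * HahnSeries.C h + HahnSeries.C g * B + A * B = E ∧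
      A.coeff 0 = 0 ∧ B.coeff 0 = 0 ∧ ∀ q, A.coeff q ∈ U ∧ B.coeff q ∈ V := by
  choose u v huv using show ∀ w : W, ∃ (u : U) (v : V), (u * h + g * v : R) = w by simpa using hW
  let A (x : Q → U × V) : HahnSeries Q R := ofCoeffNeZero fun q => (x q).1
  let B (x : Q → U × V) : HahnSeries Q R := ofCoeffNeZero fun q => (x q).2
  have error_mem (x : Q → U × V) (q : Q) : E.coeff q - (A x * B x).coeff q ∈ W := by
    refine W.sub_mem (hE q) ?_
    rw [coeff_mul_eq_sum_antidiagonal_univ]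
    exact sum_mem fun ij _ => hUV _ (coeff_ofCoeffNeZero_mem _ _) _ (coeff_ofCoeffNeZero_mem _ _)
  let error (x : Q → U × V) (q : Q) : W := ⟨_, error_mem x q⟩
  obtain ⟨x, hx⟩ := exists_fixedPoint_of_wellFounded (wellFounded_lt (α := Q))
    (fun (x : Q → U × V) q => (u (error x q), v (error x q))) fun x y q hxy => by
      have : error x q = error y q := Subtype.ext <| congrArg (E.coeff q - ·) <|
        coeff_ofCoeffNeZero_mul_congr hQ (by simp +contextual [hxy]) (by simp +contextual [hxy])
      simp only [this]
  refine ⟨A x, B x, ?_, coeff_ofCoeffNeZero_zero _, coeff_ofCoeffNeZero_zero _,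
    fun q => ⟨coeff_ofCoeffNeZero_mem _ _, coeff_ofCoeffNeZero_mem _ _⟩⟩
  ext q
  rw [HahnSeries.coeff_add, HahnSeries.coeff_add, HahnSeries.C_apply, HahnSeries.C_apply,
    HahnSeries.coeff_mul_single_zero, HahnSeries.coeff_single_zero_mul]
  rcases eq_or_ne q 0 with rfl | hq
  · simp [coeff_zero_mul hQ, A, B, coeff_ofCoeffNeZero_zero, hE₀]
  · have hsolve : ((x q).1 * h + g * (x q).2 : R) = E.coeff q - (A x * B x).coeff q := by
      nth_rewrite 1 2 [← hx]
      exact huv (error x q)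
    rw [coeff_ofCoeffNeZero_of_ne _ hq, coeff_ofCoeffNeZero_of_ne _ hq, hsolve, sub_add_cancel]

theorem exists_mul_eq_of_linearized_solvable (hQ : ∀ q : Q, 0 ≤ q) {R : Type*} [Ring R]
    {U V W : AddSubgroup R} {g h : R} (hUV : ∀ u ∈ U, ∀ v ∈ V, u * v ∈ W)
    (hW : ∀ w ∈ W, ∃ u ∈ U, ∃ v ∈ V, u * h + g * v = w) {F : HahnSeries Q R}
    (hF₀ : F.coeff 0 = g * h) (hF : ∀ q ≠ 0, F.coeff q ∈ W) :
    ∃ G H : HahnSeries Q R, G * H = F ∧ G.coeff 0 = g ∧ H.coeff 0 = h ∧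
      ∀ q ≠ 0, G.coeff q ∈ U ∧ H.coeff q ∈ V := by
  have hE₀ : (F - HahnSeries.C (g * h)).coeff 0 = 0 := by simp [hF₀]
  have hE (q : Q) : (F - HahnSeries.C (g * h)).coeff q ∈ W := by
    rcases eq_or_ne q 0 with rfl | hq
    · exact hE₀ ▸ W.zero_mem
    · simpa [HahnSeries.coeff_single_of_ne hq] using hF q hq
  obtain ⟨A, B, hAB, hA₀, hB₀, hmem⟩ := exists_mul_C_add_C_mul_add_mul_eq hQ hUV hW hE₀ hE
  refine ⟨HahnSeries.C g + A, HahnSeries.C h + B, ?_, by simp [hA₀], by simp [hB₀],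
    fun q hq => by simpa [HahnSeries.coeff_single_of_ne hq] using hmem q⟩
  rw [eq_sub_iff_add_eq, map_mul] at hAB
  rw [← hAB]
  noncomm_ring

theorem exists_degreeLT_mul_add_mul_eq {R : Type*} [CommRing R] {g h : R[X]} (hg : g.Monic)
    (hgh : IsCoprime g h) {w : R[X]} (hw : w ∈ degreeLT R (g.natDegree + h.natDegree)) :
    ∃ u ∈ degreeLT R g.natDegree, ∃ v ∈ degreeLT R h.natDegree, u * h + g * v = w := by
  obtain ⟨r, hr⟩ := ((isUnit_resultant_iff_isCoprime hg).mpr hgh).exists_left_inv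
  let uv := adjSylvester g h (r • ⟨w, hw⟩)
  have huv : sylvesterMap g h le_rfl le_rfl uv = ⟨w, hw⟩ := by
    rw [← LinearMap.comp_apply, sylveserMap_comp_adjSylvester, LinearMap.smul_apply,
      LinearMap.id_apply, smul_smul, mul_comm, hr, one_smul]
  exact ⟨uv.1, uv.1.2, uv.2, uv.2.2, by
    rw [add_comm, mul_comm (uv.1 : R[X])]; exact congrArg Subtype.val huv⟩

/-- A polynomial whose coefficients are series, read as a series whose coefficients are
polynomials. -/
noncomputable def seriesOfPoly {R : Type*} [Semiring R] (f : (HahnSeries Q R)[X]) :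
    HahnSeries Q R[X] :=
  ⟨fun q => ∑ i ∈ f.support, monomial i ((f.coeff i).coeff q), Set.isPWO_of_wellQuasiOrderedLE _⟩

theorem coeff_coeff_seriesOfPoly {R : Type*} [Semiring R] (f : (HahnSeries Q R)[X]) (q : Q)
    (n : ℕ) : ((seriesOfPoly f).coeff q).coeff n = (f.coeff n).coeff q := by
  simp only [seriesOfPoly, finsetSum_coeff, coeff_monomial, Finset.sum_ite_eq']
  split_ifs with h
  · rfl
  · rw [notMem_support_iff.mp h, HahnSeries.coeff_zero]

theorem natDegree_coeff_seriesOfPoly_le {R : Type*} [Semiring R] (f : (HahnSeries Q R)[X])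
    (q : Q) : ((seriesOfPoly f).coeff q).natDegree ≤ f.natDegree :=
  natDegree_le_iff_coeff_eq_zero.mpr fun i hi => by
    rw [coeff_coeff_seriesOfPoly, coeff_eq_zero_of_natDegree_lt hi, HahnSeries.coeff_zero]

theorem coeff_natDegree_coeff_seriesOfPoly {R : Type*} [Semiring R] {f : (HahnSeries Q R)[X]}
    (hf : f.Monic) (q : Q) :
    ((seriesOfPoly f).coeff q).coeff f.natDegree = (1 : HahnSeries Q R).coeff q := by
  rw [coeff_coeff_seriesOfPoly, hf.coeff_natDegree]

theorem monic_coeff_seriesOfPoly_zero {R : Type*} [Semiring R] {f : (HahnSeries Q R)[X]}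
    (hf : f.Monic) : ((seriesOfPoly f).coeff 0).Monic :=
  monic_of_natDegree_le_of_coeff_eq_one f.natDegree (natDegree_coeff_seriesOfPoly_le f 0) <| by
    rw [coeff_natDegree_coeff_seriesOfPoly hf, HahnSeries.coeff_one, if_pos rfl]

theorem natDegree_coeff_seriesOfPoly_zero {R : Type*} [Semiring R] [Nontrivial R]
    {f : (HahnSeries Q R)[X]} (hf : f.Monic) :
    ((seriesOfPoly f).coeff 0).natDegree = f.natDegree :=
  natDegree_eq_of_le_of_coeff_ne_zero (natDegree_coeff_seriesOfPoly_le f 0) <| by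
    rw [coeff_natDegree_coeff_seriesOfPoly hf, HahnSeries.coeff_one, if_pos rfl]
    exact one_ne_zero

theorem coeff_seriesOfPoly_mem_degreeLT {R : Type*} [Semiring R] {f : (HahnSeries Q R)[X]}
    (hf : f.Monic) {q : Q} (hq : q ≠ 0) :
    (seriesOfPoly f).coeff q ∈ degreeLT R f.natDegree := by
  refine mem_degreeLT.mpr <| (degree_lt_iff_coeff_zero _ _).mpr fun i hi => ?_
  rcases hi.eq_or_lt with rfl | hi
  · rw [coeff_natDegree_coeff_seriesOfPoly hf, HahnSeries.coeff_one, if_neg hq]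
  · exact coeff_eq_zero_of_natDegree_lt ((natDegree_coeff_seriesOfPoly_le f q).trans_lt hi)

theorem seriesOfPoly_injective {R : Type*} [Semiring R] :
    Function.Injective (seriesOfPoly : (HahnSeries Q R)[X] → HahnSeries Q R[X]) := by
  intro f g hfg
  ext n q
  rw [← coeff_coeff_seriesOfPoly, ← coeff_coeff_seriesOfPoly, hfg]

theorem seriesOfPoly_mul {R : Type*} [Semiring R] (f g : (HahnSeries Q R)[X]) :
    seriesOfPoly (f * g) = seriesOfPoly f * seriesOfPoly g := by
  ext q n
  simp only [coeff_coeff_seriesOfPoly, coeff_mul, HahnSeries.coeff_sum,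
    coeff_mul_eq_sum_antidiagonal_univ, finsetSum_coeff]
  exact Finset.sum_comm

theorem exists_monic_seriesOfPoly_eq {R : Type*} [Semiring R] {g : R[X]} (hg : g.Monic)
    {G : HahnSeries Q R[X]} (hG₀ : G.coeff 0 = g)
    (hG : ∀ q ≠ 0, G.coeff q ∈ degreeLT R g.natDegree) :
    ∃ f : (HahnSeries Q R)[X], f.Monic ∧ seriesOfPoly f = G := by
  have hdeg (q : Q) : (G.coeff q).natDegree ≤ g.natDegree := by
    rcases eq_or_ne q 0 with rfl | hq
    · rw [hG₀]
    · exact natDegree_le_of_degree_le (mem_degreeLT.mp (hG q hq)).le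
  let f : (HahnSeries Q R)[X] := ∑ i ∈ Finset.range (g.natDegree + 1),
    monomial i ⟨fun q => (G.coeff q).coeff i, Set.isPWO_of_wellQuasiOrderedLE _⟩
  have hf (i : ℕ) (q : Q) : (f.coeff i).coeff q = (G.coeff q).coeff i := by
    simp only [f, finsetSum_coeff, coeff_monomial, Finset.sum_ite_eq', Finset.mem_range]
    split_ifs with hi
    · rfl
    · rw [HahnSeries.coeff_zero, coeff_eq_zero_of_natDegree_lt ((hdeg q).trans_lt (by omega))]
  refine ⟨f, monic_of_natDegree_le_of_coeff_eq_one g.natDegree ?_ ?_, ?_⟩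
  · refine natDegree_sum_le_of_forall_le _ _ fun i hi => (natDegree_monomial_le _).trans ?_
    exact Nat.lt_succ_iff.mp (Finset.mem_range.mp hi)
  · ext q
    rw [hf, HahnSeries.coeff_one]
    split_ifs with hq
    · rw [hq, hG₀, hg.coeff_natDegree]
    · exact coeff_eq_zero_of_degree_lt (mem_degreeLT.mp (hG q hq))
  · ext q i
    rw [coeff_coeff_seriesOfPoly, hf]

theorem exists_monic_mul_eq_of_isCoprime (hQ : ∀ q : Q, 0 ≤ q) {R : Type*} [CommRing R]
    [Nontrivial R] {f : (HahnSeries Q R)[X]} (hf : f.Monic) {g h : R[X]} (hg : g.Monic)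
    (hh : h.Monic) (hgh : IsCoprime g h) (hfgh : (seriesOfPoly f).coeff 0 = g * h) :
    ∃ G H : (HahnSeries Q R)[X], G.Monic ∧ (seriesOfPoly G).coeff 0 = g ∧ G * H = f := by
  have hdeg : f.natDegree = g.natDegree + h.natDegree := by
    rw [← natDegree_coeff_seriesOfPoly_zero hf, hfgh, hg.natDegree_mul hh]
  have hmul : ∀ u ∈ degreeLT R g.natDegree, ∀ v ∈ degreeLT R h.natDegree,
      u * v ∈ degreeLT R f.natDegree := fun u hu v hv => by
    rw [mem_degreeLT] at hu hv ⊢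
    rw [hdeg, Nat.cast_add]
    exact (degree_mul_le_of_le hu.le le_rfl).trans_lt
      (WithBot.add_lt_add_left (WithBot.natCast_ne_bot _) hv)
  obtain ⟨G, H, hGH, hG₀, hH₀, hmem⟩ := exists_mul_eq_of_linearized_solvable hQ
    (U := (degreeLT R g.natDegree).toAddSubgroup) (V := (degreeLT R h.natDegree).toAddSubgroup)
    (W := (degreeLT R f.natDegree).toAddSubgroup) hmul
    (fun w hw => exists_degreeLT_mul_add_mul_eq hg hgh (hdeg ▸ hw)) hfgh
    fun q hq => coeff_seriesOfPoly_mem_degreeLT hf hq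
  obtain ⟨G, hG, rfl⟩ := exists_monic_seriesOfPoly_eq hg hG₀ fun q hq => (hmem q hq).1
  obtain ⟨H, -, rfl⟩ := exists_monic_seriesOfPoly_eq hh hH₀ fun q hq => (hmem q hq).2
  exact ⟨G, H, hG, hG₀, seriesOfPoly_injective ((seriesOfPoly_mul G H).trans hGH)⟩

end Hensel

section Polynomial

open Polynomial

theorem exists_isCoprime_mul_eq {k : Type*} [Field k] [IsAlgClosed k] {f : k[X]} (hf : f.Monic)
    (hpow : ∀ a, f ≠ (X - C a) ^ f.natDegree) :
    ∃ g h : k[X], g.Monic ∧ h.Monic ∧ IsCoprime g h ∧ f = g * h ∧ g ≠ 1 ∧ h ≠ 1 := by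
  have hdeg : f.degree ≠ 0 := fun h => hpow 0 <| by
    rw [hf.degree_le_zero_iff_eq_one.mp h.le, natDegree_one, pow_zero]
  obtain ⟨a, ha⟩ := IsAlgClosed.exists_root f hdeg
  obtain ⟨h, hfh, hdvd⟩ := exists_eq_pow_rootMultiplicity_mul_and_not_dvd f hf.ne_zero a
  have hmult : f.rootMultiplicity a ≠ 0 := ((rootMultiplicity_pos hf.ne_zero).mpr ha).ne'
  have hg : ((X - C a) ^ f.rootMultiplicity a).Monic := (monic_X_sub_C a).pow _
  refine ⟨_, h, hg, hg.of_mul_monic_left (hfh ▸ hf), IsCoprime.pow_left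
    ((irreducible_X_sub_C a).coprime_iff_not_dvd.mpr hdvd), hfh, fun hg₁ => hmult ?_, ?_⟩
  · simpa using congrArg natDegree hg₁
  · rintro rfl
    rw [mul_one] at hfh
    refine hpow a (hfh.trans ?_)
    conv_rhs => rw [hfh]
    simp

theorem eq_zero_of_nextCoeff_X_sub_C_pow {R : Type*} [CommRing R] [IsDomain R] [CharZero R]
    {a : R} {n : ℕ} (hn : n ≠ 0) (h : ((X - C a) ^ n).nextCoeff = 0) : a = 0 := by
  rw [(monic_X_sub_C a).nextCoeff_pow, nextCoeff_X_sub_C] at h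
  simpa [hn] using h

theorem nextCoeff_taylor {R : Type*} [CommRing R] {p : R[X]} (hp : p.Monic) (c : R) :
    (taylor c p).nextCoeff = p.nextCoeff + p.natDegree * c := by
  rcases Nat.eq_zero_or_pos p.natDegree with hn | hn
  · simp [nextCoeff, hn]
  have hderiv : (hasseDeriv (p.natDegree - 1) p).natDegree < 2 :=
    (natDegree_hasseDeriv_le p _).trans_lt (by omega)
  rw [nextCoeff_of_natDegree_pos hn, nextCoeff_of_natDegree_pos (by rwa [natDegree_taylor]),
    natDegree_taylor, taylor_coeff, eval_eq_sum_range' hderiv, Finset.sum_range_succ,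
    Finset.sum_range_one, hasseDeriv_coeff, hasseDeriv_coeff, Nat.add_sub_cancel' hn,
    hp.coeff_natDegree, Nat.choose_symm hn, Nat.choose_one_right]
  simp

theorem exists_nextCoeff_taylor_eq_zero {F : Type*} [Field F] [CharZero F] {p : F[X]}
    (hp : p.Monic) (hn : p.natDegree ≠ 0) : ∃ c, (taylor c p).nextCoeff = 0 := by
  refine ⟨-p.nextCoeff / p.natDegree, ?_⟩
  rw [nextCoeff_taylor hp, mul_div_cancel₀ _ (Nat.cast_ne_zero.mpr hn), add_neg_cancel]

end Polynomial

section Nullstellensatz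

open MvPolynomial

theorem exists_mem_ideal_of_finite_zeroLocus {k σ : Type*} [Field k] [IsAlgClosed k] [Finite σ]
    {I : Ideal (MvPolynomial σ k)} (hI : (zeroLocus k I).Finite)
    {T : Submonoid (MvPolynomial σ k)} (hT : ∀ φ ∈ zeroLocus k I, ∃ f ∈ T, eval φ f = 0) :
    ∃ f ∈ T, f ∈ I := by
  choose! f hfT hf using hT
  let g := ∏ φ ∈ hI.toFinset, f φ
  have hgT : g ∈ T := T.prod_mem fun φ hφ => hfT φ (hI.mem_toFinset.mp hφ)
  have hg : g ∈ I.radical := by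
    rw [← vanishingIdeal_zeroLocus_eq_radical (K := k), mem_vanishingIdeal_iff]
    intro φ hφ
    rw [MvPolynomial.aeval_eq_eval, map_prod]
    exact Finset.prod_eq_zero (hI.mem_toFinset.mpr hφ) (hf φ hφ)
  obtain ⟨m, hm⟩ := hg
  exact ⟨g ^ m, T.pow_mem hgT m, hm⟩

end Nullstellensatz

section Cone

theorem exists_sub_mem_hull_or_exists_sum_eq {E ι : Type*} [AddCommGroup E] [Module ℝ E]
    {s : Finset ι} {v : ι → E} {y : E} (hy : y ∈ PointedCone.hull ℝ (v '' s)) (m : ℝ) :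
    (∃ i ∈ s, y - m • v i ∈ PointedCone.hull ℝ (v '' s)) ∨
      ∃ a : ι → ℝ, (∀ i ∈ s, a i ≤ m) ∧ ∑ i ∈ s, a i • v i = y := by
  classical
  obtain ⟨a, ha⟩ := (Submodule.mem_span_image_finset_iff_exists_fun' _).mp hy
  have hv : ∀ i ∈ s, v i ∈ PointedCone.hull ℝ (v '' s) := fun i hi =>
    Submodule.subset_span ⟨i, hi, rfl⟩
  by_cases hlarge : ∃ i ∈ s, m ≤ a i
  · obtain ⟨i, hi, hm⟩ := hlarge
    have hsub : y - m • v i = (a i - m) • v i + ∑ j ∈ s.erase i, a j • v j := by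
      rw [← ha, ← Finset.add_sum_erase s _ hi, sub_smul]
      exact add_sub_right_comm _ _ _
    refine Or.inl ⟨i, hi, hsub ▸ Submodule.add_mem _ ?_ ?_⟩
    · exact Submodule.smul_mem _ (⟨_, sub_nonneg.mpr hm⟩ : {c : ℝ // 0 ≤ c}) (hv i hi)
    · exact Submodule.sum_mem _ fun j hj =>
        Submodule.smul_mem _ (a j) (hv j (Finset.mem_of_mem_erase hj))
  · push Not at hlarge
    exact Or.inr ⟨fun i => a i, fun i hi => (hlarge i hi).le, ha⟩

variable {N : ℕ} {ω : Fin N → ℝ}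

theorem toReal_zero : toReal (0 : Fin N → ℚ) = 0 := by
  funext i
  simp [toReal]

theorem toReal_injective : Function.Injective (toReal : (Fin N → ℚ) → Fin N → ℝ) :=
  fun _ _ h => funext fun i => Rat.cast_injective (congrFun h i)

theorem dot_nsmul (ω : Fin N → ℝ) (m : ℕ) (α : Fin N → ℚ) : dot ω (m • α) = m * dot ω α := by
  simp [dot, Finset.mul_sum, mul_left_comm]

theorem dot_eq_sum_of_toReal_eq {ι : Type*} {s : Finset ι} {v : ι → Fin N → ℚ} {a : ι → ℝ}
    {α : Fin N → ℚ} (h : ∑ i ∈ s, a i • toReal (v i) = toReal α) :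
    dot ω α = ∑ i ∈ s, a i * dot ω (v i) := by
  change ω ⬝ᵥ toReal α = ∑ i ∈ s, a i • (ω ⬝ᵥ toReal (v i))
  simp only [← h, dotProduct_sum, dotProduct_smul]

theorem IsRationalCone.exists_finset_dot_pos (hω : LinearIndependent ℚ ω)
    {σ : PointedCone ℝ (Fin N → ℝ)} (hσ : IsRationalCone σ) (hσω : IsPositiveCone ω σ) :
    ∃ s : Finset (Fin N → ℚ), (∀ v ∈ s, 0 < dot ω v) ∧
      σ = PointedCone.hull ℝ (toReal '' (s : Set (Fin N → ℚ))) := by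
  classical
  obtain ⟨s, rfl⟩ := hσ
  refine ⟨s.erase 0, fun v hv => ?_, ?_⟩
  · obtain ⟨hv₀, hvs⟩ := Finset.mem_erase.mp hv
    refine lt_of_le_of_ne (hσω _ (Submodule.subset_span ⟨v, hvs, rfl⟩)) fun h => hv₀ ?_
    exact dot_injective hω (h.symm.trans (dot_zero ω).symm)
  · rw [Finset.coe_erase, Set.image_sdiff toReal_injective, Set.image_singleton, toReal_zero]
    exact (Submodule.span_sdiff_singleton_zero ..).symm

/-- Let `σ` be spanned by `s` and `γ + E ⊆ σ`, and let `m` be large. A point `γ + α` with a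
coefficient at least `m` at some `v ∈ s` gives `α ∈ (m v - γ) + σ`, with `m v - γ` non-negative; the
remaining `α ∈ E` have bounded value, hence are finitely many. -/
theorem Admissible.exists_hull (hω : LinearIndependent ℚ ω) {E : Set (Fin N → ℚ)}
    (hE : Admissible ω E) (hE₀ : ∀ α ∈ E, 0 ≤ dot ω α) :
    ∃ t : Finset (Fin N → ℚ), (∀ v ∈ t, 0 ≤ dot ω v) ∧
      ∀ α ∈ E, toReal α ∈ PointedCone.hull ℝ (toReal '' (t : Set (Fin N → ℚ))) := by
  classical
  obtain ⟨-, γ, σ, hσ, hσω, hEσ⟩ := id hE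
  obtain ⟨s, hs, rfl⟩ := hσ.exists_finset_dot_pos hω hσω
  obtain ⟨m, hm⟩ : ∃ m : ℕ, ∀ v ∈ s, dot ω γ ≤ m * dot ω v := by
    obtain ⟨b, hb⟩ := (s.image fun v => dot ω γ / dot ω v).bddAbove
    obtain ⟨m, hm⟩ := exists_nat_ge b
    exact ⟨m, fun v hv => (div_le_iff₀ (hs v hv)).mp
      ((hb (Finset.mem_image_of_mem _ hv)).trans hm)⟩
  have hfin := hE.finite_le hω (m * ∑ v ∈ s, dot ω v - dot ω γ)
  refine ⟨s ∪ s.image (fun v => m • v - γ) ∪ hfin.toFinset, fun v hv => ?_, fun α hα => ?_⟩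
  · rcases Finset.mem_union.mp hv with hv | hv
    · rcases Finset.mem_union.mp hv with hv | hv
      · exact (hs v hv).le
      · obtain ⟨w, hw, rfl⟩ := Finset.mem_image.mp hv
        rw [sub_eq_add_neg, dot_add, dot_neg, dot_nsmul]
        linarith [hm w hw]
    · exact hE₀ v (hfin.mem_toFinset.mp hv).1
  rcases exists_sub_mem_hull_or_exists_sum_eq (hEσ α hα) m with ⟨v, hv, hsub⟩ | ⟨a, ham, ha⟩
  · have hα_eq : toReal α = toReal (m • v - γ) + (toReal (α + γ) - (m : ℝ) • toReal v) := by
      funext i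
      simp [toReal]
    rw [hα_eq]
    refine Submodule.add_mem _ (Submodule.subset_span ⟨_, ?_, rfl⟩)
      (Submodule.span_mono (Set.image_mono ?_) hsub)
    · exact Finset.mem_union_left _ (Finset.mem_union_right _ (Finset.mem_image_of_mem _ hv))
    · exact Finset.coe_subset.mpr
        (Finset.subset_union_left.trans Finset.subset_union_left)
  · refine Submodule.subset_span ⟨α, Finset.mem_union_right _ (hfin.mem_toFinset.mpr ⟨hα, ?_⟩), rfl⟩
    have hle : dot ω (α + γ) ≤ m * ∑ v ∈ s, dot ω v := by
      rw [dot_eq_sum_of_toReal_eq ha, Finset.mul_sum]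
      exact Finset.sum_le_sum fun v hv => mul_le_mul_of_nonneg_right (ham v hv) (hs v hv).le
    rw [dot_add] at hle
    linarith

/-- The monoid of the points of the lattice `(1/k) ℤ^N` which lie in the cone `σ`. -/
def latticePoints (ω : Fin N → ℝ) (k : ℕ) (σ : PointedCone ℝ (Fin N → ℝ)) :
    AddSubmonoid (Expo ω) where
  carrier := {α : Fin N → ℚ | (∀ i, ∃ m : ℤ, α i = (m : ℚ) / (k : ℚ)) ∧ toReal α ∈ σ}
  zero_mem' := ⟨fun _ => ⟨0, by simp; rfl⟩, toReal_zero.symm ▸ σ.zero_mem⟩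
  add_mem' := by
    rintro α β ⟨hα, hασ⟩ ⟨hβ, hβσ⟩
    refine ⟨fun i => ?_, toReal_add α β ▸ σ.add_mem hασ hβσ⟩
    obtain ⟨m, hm⟩ := hα i
    obtain ⟨n, hn⟩ := hβ i
    exact ⟨m + n, (congrArg₂ (· + ·) hm hn).trans (by push_cast; ring)⟩

theorem admissible_latticePoints {k : ℕ} (hk : 0 < k) {σ : PointedCone ℝ (Fin N → ℝ)}
    (hσ : IsRationalCone σ) (hσω : IsPositiveCone ω σ) :
    Admissible ω (latticePoints ω k σ : Set (Expo ω)) :=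
  ⟨⟨k, hk, fun _ hα => hα.1⟩, 0, σ, hσ, hσω, fun α hα => (add_zero α).symm ▸ hα.2⟩

theorem Expo.nonneg_iff (hω : LinearIndependent ℚ ω) {α : Expo ω} : 0 ≤ α ↔ 0 ≤ dot ω α := by
  rw [Expo.le_iff_dot_le hω]
  exact iff_of_eq (congrArg (· ≤ dot ω α) (dot_zero ω))

theorem Admissible.exists_addSubmonoid (hω : LinearIndependent ℚ ω) {E : Set (Expo ω)}
    (hE : Admissible ω E) (hE₀ : ∀ α ∈ E, 0 ≤ α) :
    ∃ P : AddSubmonoid (Expo ω), Admissible ω (P : Set (Expo ω)) ∧ E ⊆ P ∧ ∀ p ∈ P, 0 ≤ p := by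
  obtain ⟨t, ht, hEt⟩ := hE.exists_hull hω fun α hα => (Expo.nonneg_iff hω).mp (hE₀ α hα)
  obtain ⟨k, hk, hEk⟩ := hE.1
  exact ⟨latticePoints ω k _, admissible_latticePoints hk (isRationalCone_hull t)
    (isPositiveCone_hull ht), fun α hα => ⟨hEk α hα, hEt α hα⟩,
    fun α hα => (Expo.nonneg_iff hω).mpr (isPositiveCone_hull ht _ hα.2)⟩

theorem Admissible.biUnion {ι : Type*} (s : Finset ι) {E : ι → Set (Fin N → ℚ)}
    (h : ∀ i ∈ s, Admissible ω (E i)) : Admissible ω (⋃ i ∈ s, E i) := by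
  classical
  induction s using Finset.induction_on with
  | empty => exact (admissible_singleton ω 0).mono (by simp)
  | insert a s _ ih =>
    rw [Finset.set_biUnion_insert]
    exact (h a (Finset.mem_insert_self _ _)).union
      (ih fun i hi => h i (Finset.mem_insert_of_mem hi))

end Cone

section Field

variable {N : ℕ} {ω : Fin N → ℝ}

noncomputable instance [Fact (LinearIndependent ℚ ω)] : LinearOrder (Expo ω) where
  le_total α β := by
    simpa only [Expo.le_iff_dot_le Fact.out] using le_total (dot ω α) (dot ω β)
  toDecidableLE := Classical.decRel _

theorem Admissible.wellQuasiOrderedLE (hω : LinearIndependent ℚ ω) {P : AddSubmonoid (Expo ω)}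
    (hP : Admissible ω (P : Set (Expo ω))) : WellQuasiOrderedLE P :=
  ⟨hP.isPWO hω⟩

variable {K : Type*} [Field K]

/-- The inclusion into `S_ω` of the series whose exponents lie in an admissible monoid. -/
noncomputable def ofSubmonoid {P : AddSubmonoid (Expo ω)} (hP : Admissible ω (P : Set (Expo ω))) :
    HahnSeries P K →+* S ω K :=
  (HahnSeries.embDomainRingHom P.subtype P.subtype_injective fun _ _ => Iff.rfl).codRestrict
    (puiseux ω K) fun _ => hP.mono <| HahnSeries.support_embDomain_subset.trans <| by
      rintro _ ⟨p, -, rfl⟩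
      exact p.2

theorem coeff_ofSubmonoid {P : AddSubmonoid (Expo ω)} (hP : Admissible ω (P : Set (Expo ω)))
    (a : HahnSeries P K) (p : P) : (ofSubmonoid hP a).1.coeff p = a.coeff p :=
  HahnSeries.embDomain_coeff

theorem mem_range_ofSubmonoid (hω : LinearIndependent ℚ ω) {P : AddSubmonoid (Expo ω)}
    (hP : Admissible ω (P : Set (Expo ω))) {a : S ω K} (ha : a.1.support ⊆ P) :
    a ∈ Set.range (ofSubmonoid (K := K) hP) := by
  have := hP.wellQuasiOrderedLE hω
  refine ⟨⟨fun p => a.1.coeff p, Set.isPWO_of_wellQuasiOrderedLE _⟩, ?_⟩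
  ext α
  by_cases hα : α ∈ P
  · exact coeff_ofSubmonoid hP _ ⟨α, hα⟩
  · rw [Function.notMem_support.mp fun h => hα (ha h)]
    refine HahnSeries.embDomain_notin_image_support fun h => hα ?_
    obtain ⟨p, -, rfl⟩ := h
    exact p.2

theorem coeff_monomialSeries_mul (α β : Expo ω) (c : K) (a : S ω K) :
    (monomialSeries ω α c * a).1.coeff β = c * a.1.coeff (β - α) := by
  have := HahnSeries.coeff_single_mul_add (r := c) (x := a.1) (a := β - α) (b := α)
  rwa [sub_add_cancel] at this

theorem monomialSeries_mul_monomialSeries (α β : Expo ω) (c d : K) :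
    monomialSeries ω α c * monomialSeries ω β d = monomialSeries ω (α + β) (c * d) :=
  Subtype.ext HahnSeries.single_mul_single

theorem coeff_order_ne_zero {a : S ω K} (ha : a ≠ 0) : a.1.coeff a.1.order ≠ 0 :=
  fun h => ha (Subtype.ext (HahnSeries.coeff_order_eq_zero.mp h))

theorem isUnit_monomialSeries (α : Expo ω) {c : K} (hc : c ≠ 0) :
    IsUnit (monomialSeries ω α c) :=
  IsUnit.of_mul_eq_one (monomialSeries ω (-α) c⁻¹) <| by
    rw [monomialSeries_mul_monomialSeries, add_neg_cancel, mul_inv_cancel₀ hc]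
    rfl

variable [Fact (LinearIndependent ℚ ω)]

theorem isUnit_of_order_eq_zero {a : S ω K} (ha : a ≠ 0) (ha₀ : a.1.order = 0) : IsUnit a := by
  obtain ⟨P, hP, haP, hP₀⟩ := a.2.exists_addSubmonoid (E := a.1.support) Fact.out fun α hα =>
    ha₀ ▸ HahnSeries.order_le_of_coeff_ne_zero hα
  obtain ⟨b, rfl⟩ := mem_range_ofSubmonoid Fact.out hP haP
  have hb₀ : b.coeff 0 ≠ 0 := by
    rw [← coeff_ofSubmonoid hP, ZeroMemClass.coe_zero, ← ha₀]
    exact coeff_order_ne_zero ha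
  have hb : b.order = 0 := le_antisymm (HahnSeries.order_le_of_coeff_ne_zero hb₀) (hP₀ _ b.order.2)
  refine (HahnSeries.isUnit_of_isUnit_leadingCoeff_AddUnitOrder ?_ ?_).map _
  · rw [HahnSeries.leadingCoeff_eq, hb]
    exact hb₀.isUnit
  · rw [hb]
    exact isAddUnit_zero

theorem isUnit_of_ne_zero {a : S ω K} (ha : a ≠ 0) : IsUnit a := by
  have hm := isUnit_monomialSeries (K := K) (-a.1.order) one_ne_zero
  have hma : monomialSeries ω (-a.1.order) 1 * a ≠ 0 := by
    rwa [Ne, hm.mul_right_eq_zero]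
  refine isUnit_of_mul_isUnit_right (isUnit_of_order_eq_zero hma ?_)
  rw [Subring.coe_mul, HahnSeries.order_mul (hm.ne_zero <| Subtype.ext ·) (ha <| Subtype.ext ·)]
  exact (congrArg (· + a.1.order) (HahnSeries.order_single one_ne_zero)).trans (neg_add_cancel _)

noncomputable instance : Field (S ω K) :=
  Field.ofIsUnitOrEqZero fun _ => or_iff_not_imp_right.mpr isUnit_of_ne_zero

end Field

section ResidueOfIrreducible

open Polynomial

variable {Q : Type*} [AddCommMonoid Q] [PartialOrder Q] [IsOrderedCancelAddMonoid Q]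
  [WellQuasiOrderedLE Q]

theorem coeff_seriesOfPoly_zero_eq_pow_of_irreducible (hQ : ∀ q : Q, 0 ≤ q) {k : Type*} [Field k]
    [IsAlgClosed k] {f : (HahnSeries Q k)[X]} (hf : f.Monic) (hirr : Irreducible f) :
    ∃ a, (seriesOfPoly f).coeff 0 = (X - C a) ^ f.natDegree := by
  by_contra! hpow
  rw [← natDegree_coeff_seriesOfPoly_zero hf] at hpow
  obtain ⟨g, h, hg, hh, hgh, hfgh, hg₁, hh₁⟩ :=
    exists_isCoprime_mul_eq (monic_coeff_seriesOfPoly_zero hf) hpow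
  obtain ⟨G, H, hG, hGg, rfl⟩ := exists_monic_mul_eq_of_isCoprime hQ hf hg hh hgh hfgh
  have hH : H.Monic := hG.of_mul_monic_left hf
  rcases hirr.isUnit_or_isUnit rfl with hG' | hH'
  · refine hg₁ (hg.natDegree_eq_zero.mp ?_)
    rw [← hGg, natDegree_coeff_seriesOfPoly_zero hG, hG.eq_one_of_isUnit hG', natDegree_one]
  · rw [hH.eq_one_of_isUnit hH', mul_one, hGg] at hfgh
    exact hh₁ (hg.isRegular.left (hfgh.symm.trans (mul_one g).symm))

end ResidueOfIrreducible

section AlgClosed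

open Polynomial

theorem irreducible_scaleRoots {R : Type*} [CommRing R] [IsDomain R] {p : R[X]} (hp : p.Monic)
    (hirr : Irreducible p) {s : R} (hs : IsUnit s) : Irreducible (p.scaleRoots s) := by
  obtain ⟨t, hst⟩ := hs.exists_right_inv
  have hp₁ : p.scaleRoots s ≠ 1 := fun h => hirr.ne_one <| hp.natDegree_eq_zero.mp <| by
    rw [← natDegree_scaleRoots p s, h, natDegree_one]
  refine ((monic_scaleRoots_iff s).mpr hp).irreducible_iff_natDegree.mpr
    ⟨hp₁, fun f g hf hg hfg => ?_⟩
  rw [← natDegree_scaleRoots f t, ← natDegree_scaleRoots g t]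
  refine (hp.irreducible_iff_natDegree.mp hirr).2 _ _
    ((monic_scaleRoots_iff t).mpr hf) ((monic_scaleRoots_iff t).mpr hg) ?_
  rw [← mul_scaleRoots_of_noZeroDivisors, hfg, ← scaleRoots_mul, hst, scaleRoots_one]

variable {N : ℕ} {ω : Fin N → ℝ}

theorem Expo.exists_nsmul_eq {n : ℕ} (hn : n ≠ 0) (α : Expo ω) : ∃ β : Expo ω, n • β = α :=
  ⟨(fun i => α i / n : Fin N → ℚ), funext fun _ => (nsmul_eq_mul _ _).trans
    (mul_div_cancel₀ _ (Nat.cast_ne_zero.mpr hn))⟩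

variable [Fact (LinearIndependent ℚ ω)]

theorem Expo.exists_forall_nsmul_le {ι : Type*} {s : Finset ι} (hs : s.Nonempty) {k : ι → ℕ}
    (hk : ∀ i ∈ s, k i ≠ 0) (o : ι → Expo ω) :
    ∃ α : Expo ω, (∀ i ∈ s, k i • α ≤ o i) ∧ ∃ i ∈ s, k i • α = o i := by
  have hroot (i) (hi : i ∈ s) : ∃ β, k i • β = o i := Expo.exists_nsmul_eq (hk i hi) (o i)
  choose! β hβ using hroot
  obtain ⟨j, hj, hmin⟩ := s.exists_min_image β hs
  exact ⟨β j, fun i hi => hβ i hi ▸ nsmul_le_nsmul_right (hmin i hi) _, j, hj, hβ j hj⟩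

variable {K : Type*} [Field K]

theorem coeff_mul_monomialSeries_neg_pow (a : S ω K) (α β : Expo ω) (n : ℕ) :
    (a * monomialSeries ω (-α) 1 ^ n).1.coeff β = a.1.coeff (β + n • α) := by
  have hpow : monomialSeries ω (-α) (1 : K) ^ n = monomialSeries ω (n • -α) (1 ^ n) :=
    Subtype.ext (HahnSeries.single_pow (-α) n 1)
  rw [mul_comm, hpow, coeff_monomialSeries_mul, one_pow, one_mul, smul_neg, sub_neg_eq_add]

/-- The scaling factor is `x^(-α)` with `α` the smallest slope `ord q_i / (n - i)`, `n = deg q`. -/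
theorem exists_isUnit_scaleRoots {q : (S ω K)[X]} (hq : q.Monic) (hne : q ≠ X ^ q.natDegree) :
    ∃ s : S ω K, IsUnit s ∧ (∀ i, ∀ α ∈ ((q.scaleRoots s).coeff i).1.support, 0 ≤ α) ∧
      ∃ i < q.natDegree, ((q.scaleRoots s).coeff i).1.coeff 0 ≠ 0 := by
  have hlow : q.eraseLead.support.Nonempty := support_nonempty.mpr fun h => hne <| by
    simpa [h, hq.leadingCoeff] using q.eraseLead_add_C_mul_X_pow.symm
  obtain ⟨α, hle, j, hj, hjα⟩ := Expo.exists_forall_nsmul_le hlow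
    (k := fun i => q.natDegree - i)
    (fun i hi => (Nat.sub_pos_of_lt (lt_natDegree_of_mem_eraseLead_support hi)).ne')
    fun i => (q.coeff i).1.order
  refine ⟨monomialSeries ω (-α) 1, isUnit_monomialSeries _ one_ne_zero, fun i β hβ => ?_, j,
    lt_natDegree_of_mem_eraseLead_support hj, ?_⟩
  · rw [HahnSeries.mem_support, coeff_scaleRoots, coeff_mul_monomialSeries_neg_pow] at hβ
    have hle' : (q.natDegree - i) • α ≤ (q.coeff i).1.order := by
      rcases eq_or_ne i q.natDegree with rfl | hi
      · rw [Nat.sub_self, zero_nsmul, hq.coeff_natDegree]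
        exact HahnSeries.order_one.ge
      · refine hle i (mem_support_iff.mpr ?_)
        rw [eraseLead_coeff_of_ne i hi]
        intro h
        simp [h] at hβ
    exact le_add_iff_nonneg_left _ |>.mp (hle'.trans (HahnSeries.order_le_of_coeff_ne_zero hβ))
  · rw [coeff_scaleRoots, coeff_mul_monomialSeries_neg_pow, zero_add, hjα]
    rw [eraseLead_support] at hj
    exact coeff_order_ne_zero (mem_support_iff.mp (Finset.mem_of_mem_erase hj))

theorem exists_monic_map_ofSubmonoid_eq {r : (S ω K)[X]} (hr : r.Monic)
    (hr₀ : ∀ i, ∀ α ∈ (r.coeff i).1.support, 0 ≤ α) :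
    ∃ (P : AddSubmonoid (Expo ω)) (hP : Admissible ω (P : Set (Expo ω)))
      (f : (HahnSeries P K)[X]), (∀ p : P, 0 ≤ p) ∧ f.Monic ∧ f.map (ofSubmonoid hP) = r := by
  have hadm := Admissible.biUnion r.support fun i _ => (r.coeff i).2
  obtain ⟨P, hP, hrP, hP₀⟩ := hadm.exists_addSubmonoid Fact.out fun α hα => by
    obtain ⟨i, -, hi⟩ := Set.mem_iUnion₂.mp hα
    exact hr₀ i α hi
  have hlift : r ∈ lifts (ofSubmonoid (K := K) hP) := by
    refine (lifts_iff_coeff_lifts r).mpr fun i =>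
      mem_range_ofSubmonoid Fact.out hP fun α hα => hrP ?_
    refine Set.mem_iUnion₂.mpr ⟨i, mem_support_iff.mpr fun h => hα ?_, hα⟩
    rw [h]
    rfl
  obtain ⟨f, hfr, -, hf⟩ := lifts_and_natDegree_eq_and_monic hlift hr
  exact ⟨P, hP, f, fun p => hP₀ p p.2, hf, hfr⟩

instance [CharZero K] : CharZero (S ω K) :=
  charZero_of_injective_ringHom (f := HahnSeries.C.codRestrict (puiseux ω K)
    fun c => (monomialSeries ω 0 c).2) (RingHom.injective _)

variable [IsAlgClosed K] [CharZero K]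

theorem eq_X_pow_of_irreducible_of_nextCoeff_eq_zero {q : (S ω K)[X]} (hq : q.Monic)
    (hirr : Irreducible q) (hnext : q.nextCoeff = 0) : q = X ^ q.natDegree := by
  by_contra hne
  have hn : q.natDegree ≠ 0 := hirr.natDegree_pos.ne'
  obtain ⟨s, hs, hnonneg, i, hi, hi₀⟩ := exists_isUnit_scaleRoots hq hne
  obtain ⟨P, hP, f, hP₀, hf, hfr⟩ := exists_monic_map_ofSubmonoid_eq
    ((monic_scaleRoots_iff s).mpr hq) hnonneg
  have := hP.wellQuasiOrderedLE Fact.out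
  have hfn : f.natDegree = q.natDegree := by
    rw [← hf.natDegree_map (ofSubmonoid hP), hfr, natDegree_scaleRoots]
  have hcoeff (j : ℕ) : ((seriesOfPoly f).coeff 0).coeff j
      = ((q.scaleRoots s).coeff j).1.coeff 0 := by
    rw [coeff_coeff_seriesOfPoly, ← coeff_ofSubmonoid hP, ← hfr, coeff_map, ZeroMemClass.coe_zero]
  have hfirr : Irreducible f := hf.irreducible_of_irreducible_map (ofSubmonoid hP) f <| by
    rw [hfr]
    exact irreducible_scaleRoots hq hirr hs
  obtain ⟨a, ha⟩ := coeff_seriesOfPoly_zero_eq_pow_of_irreducible hP₀ hf hfirr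
  have ha₀ : a = 0 := eq_zero_of_nextCoeff_X_sub_C_pow (hfn ▸ hn) <| by
    rw [nextCoeff_of_natDegree_pos (by simpa [hfn] using hirr.natDegree_pos), ← ha, hcoeff]
    rw [nextCoeff_of_natDegree_pos hirr.natDegree_pos] at hnext
    rw [coeff_scaleRoots, natDegree_coeff_seriesOfPoly_zero hf, hfn, hnext, zero_mul]
    rfl
  refine hi₀ ?_
  rw [← hcoeff, ha, ha₀, C_0, sub_zero, coeff_X_pow, hfn, if_neg hi.ne]

instance : IsAlgClosed (S ω K) := .of_exists_root _ fun p hp hirr => by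
  have hn : p.natDegree ≠ 0 := hirr.natDegree_pos.ne'
  obtain ⟨c, hc⟩ := exists_nextCoeff_taylor_eq_zero hp hn
  have hirr' : Irreducible (taylor c p) := (MulEquiv.irreducible_iff (taylorEquiv c)).mpr hirr
  have hpow := eq_X_pow_of_irreducible_of_nextCoeff_eq_zero
    ((leadingCoeff_taylor c p).trans hp) hirr' hc
  refine ⟨0 + c, ?_⟩
  rw [← taylor_eval, hpow, natDegree_taylor, eval_pow, eval_X, zero_pow hn]

end AlgClosed

section FirstTerm

variable {N : ℕ} {ω : Fin N → ℝ} {K : Type*} [Field K]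

theorem ord_eq_top_iff {a : S ω K} : ord a = ⊤ ↔ a = 0 :=
  WithTop.map_eq_top_iff.trans (HahnSeries.orderTop_eq_top.trans ZeroMemClass.coe_eq_zero)

theorem firstTerm_eq_zero_iff {a : S ω K} : firstTerm a = 0 ↔ a = 0 := by
  rw [← ZeroMemClass.coe_eq_zero]
  exact HahnSeries.single_eq_zero_iff.trans
    (HahnSeries.coeff_order_eq_zero.trans ZeroMemClass.coe_eq_zero)

theorem ord_firstTerm (a : S ω K) : ord (firstTerm a) = ord a := by
  by_cases ha : a = 0
  · rw [firstTerm_eq_zero_iff.mpr ha, ha]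
  · rw [(ord_isLeast a ha).1, (ord_isLeast _ (firstTerm_eq_zero_iff.not.mpr ha)).1]
    exact congrArg (fun α : Expo ω => (dot ω α : WithTop ℝ))
      (HahnSeries.order_single (coeff_order_ne_zero ha))

theorem firstTerm_one : firstTerm (1 : S ω K) = 1 := by
  rw [firstTerm, OneMemClass.coe_one, HahnSeries.order_one, HahnSeries.coeff_one, if_pos rfl]
  rfl

variable [Fact (LinearIndependent ℚ ω)]

theorem Expo.monotone_dot : Monotone (fun α : Expo ω => dot ω α) :=
  fun α β => (Expo.le_iff_dot_le Fact.out α β).mp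

/-- The order `ord` as an additive valuation. -/
noncomputable def ordValuation : AddValuation (S ω K) (WithTop ℝ) :=
  ((HahnSeries.addVal (Expo ω) K).map
    (AddMonoidHom.withTopMap ⟨⟨fun α : Expo ω => dot ω α, dot_zero ω⟩, dot_add ω⟩) rfl
    Expo.monotone_dot.withTop_map).comap (puiseux ω K).subtype

theorem ord_mul (a b : S ω K) : ord (a * b) = ord a + ord b :=
  ordValuation.map_mul a b

theorem ord_one : ord (1 : S ω K) = 0 :=
  ordValuation.map_one

theorem ord_le_dot {a : S ω K} {α : Expo ω} (hα : a.1.coeff α ≠ 0) : ord a ≤ dot ω α :=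
  Expo.monotone_dot.withTop_map (HahnSeries.orderTop_le_of_coeff_ne_zero hα)

theorem firstTerm_mul (a b : S ω K) : firstTerm (a * b) = firstTerm a * firstTerm b := by
  by_cases ha : a = 0
  · rw [ha, zero_mul, firstTerm_eq_zero_iff.mpr rfl, zero_mul]
  by_cases hb : b = 0
  · rw [hb, mul_zero, firstTerm_eq_zero_iff.mpr rfl, mul_zero]
  simp only [firstTerm, monomialSeries_mul_monomialSeries, ← HahnSeries.leadingCoeff_eq]
  rw [Subring.coe_mul, HahnSeries.leadingCoeff_mul,
    HahnSeries.order_mul (ha <| Subtype.ext ·) (hb <| Subtype.ext ·)]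

/-- Taking first terms, as a monoid homomorphism. -/
noncomputable def firstTermHom : S ω K →* S ω K := ⟨⟨firstTerm, firstTerm_one⟩, firstTerm_mul⟩

end FirstTerm

section TermsAt

variable {N : ℕ} {ω : Fin N → ℝ} {K : Type*} [Field K]

/-- The terms `c_α x^α` of a series with `ω · α + v = p`. They are the terms of the series that
contribute to the part of order `p` of a polynomial if the series is the coefficient of a monomial
of weight `v`; the case `v = 0` singles out the exponents with `ω · α = p`. -/
noncomputable def termsAt (v : WithTop ℝ) (p : ℝ) : S ω K →+ S ω K where
  toFun a :=
    have hsub : (Set.indicator {α : Expo ω | dot ω α + v = p} a.1.coeff).support ⊆ a.1.support :=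
      Set.support_indicator.trans_subset Set.inter_subset_right
    ⟨⟨_, a.1.isPWO_support.mono hsub⟩, a.2.mono hsub⟩
  map_zero' := Subtype.ext (HahnSeries.ext (Set.indicator_zero _ _))
  map_add' _ _ := Subtype.ext (HahnSeries.ext (Set.indicator_add _ _ _))

theorem coeff_termsAt (v : WithTop ℝ) (p : ℝ) (a : S ω K) :
    (termsAt v p a).1.coeff = Set.indicator {α : Expo ω | dot ω α + v = p} a.1.coeff :=
  rfl

variable [Fact (LinearIndependent ℚ ω)]

theorem termsAt_of_lt {v : WithTop ℝ} {p : ℝ} {a : S ω K} (h : p < ord a + v) :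
    termsAt v p a = 0 := by
  refine Subtype.ext (HahnSeries.ext (Set.indicator_eq_zero.mpr ?_))
  refine Set.disjoint_left.mpr fun α hα (hαp : dot ω α + v = p) => h.not_ge ?_
  exact (add_le_add_left (ord_le_dot hα) v).trans_eq hαp

theorem termsAt_of_eq {v : WithTop ℝ} {p : ℝ} {a : S ω K} (h : ord a + v = p) :
    termsAt v p a = firstTerm a := by
  have htop := WithTop.add_ne_top.mp (h.trans_ne WithTop.coe_ne_top)
  rw [(ord_isLeast a (ord_eq_top_iff.not.mp htop.1)).1] at h
  refine Subtype.ext (HahnSeries.ext (funext fun α => ?_))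
  rw [coeff_termsAt]
  by_cases hα : α = a.1.order
  · subst hα
    exact (Set.indicator_of_mem (s := {α : Expo ω | dot ω α + v = p}) h a.1.coeff).trans
      (HahnSeries.coeff_single_same _ _).symm
  · refine (Set.indicator_of_notMem (fun hαp => hα ?_) a.1.coeff).trans
      (HahnSeries.coeff_single_of_ne hα).symm
    exact dot_injective Fact.out (WithTop.coe_inj.mp
      ((WithTop.add_right_inj htop.2).mp (Eq.trans hαp h.symm)))

theorem termsAt_mul {v w : WithTop ℝ} {p q : ℝ} {a b : S ω K} (ha : p ≤ ord a + v)
    (hb : q ≤ ord b + w) :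
    termsAt (v + w) (p + q) (a * b) = termsAt v p a * termsAt w q b := by
  have hab : ord (a * b) + (v + w) = ord a + v + (ord b + w) := by rw [ord_mul, add_add_add_comm]
  rcases ha.lt_or_eq with ha' | ha'
  · rw [termsAt_of_lt ha', zero_mul, termsAt_of_lt]
    rw [hab, WithTop.coe_add]
    exact WithTop.add_lt_add_of_lt_of_le WithTop.coe_ne_top ha' hb
  rcases hb.lt_or_eq with hb' | hb'
  · rw [termsAt_of_lt hb', mul_zero, termsAt_of_lt]
    rw [hab, WithTop.coe_add]
    exact WithTop.add_lt_add_of_le_of_lt WithTop.coe_ne_top ha hb'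
  · rw [termsAt_of_eq ha'.symm, termsAt_of_eq hb'.symm, ← firstTerm_mul, termsAt_of_eq]
    rw [hab, ← ha', ← hb', WithTop.coe_add]

theorem termsAt_ord_mul_firstTerm {p : ℝ} {a b : S ω K} (h : p ≤ ord a + ord b) :
    termsAt (ord b) p a * firstTerm b = termsAt 0 p (a * b) := by
  have hab : ord (a * b) + 0 = ord a + ord b := by rw [ord_mul, add_zero]
  rcases h.lt_or_eq with h | h
  · rw [termsAt_of_lt h, zero_mul, termsAt_of_lt (h.trans_eq hab.symm)]
  · rw [termsAt_of_eq h.symm, ← firstTerm_mul, termsAt_of_eq (hab.trans h.symm)]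

end TermsAt

section LevelPart

open MvPolynomial

variable {N M : ℕ} {ω : Fin N → ℝ} {K : Type*} [Field K] {η : Fin M → WithTop ℝ}

theorem weight_zero (η : Fin M → WithTop ℝ) : weight η 0 = 0 := by
  simp [weight]

theorem weight_add (η : Fin M → WithTop ℝ) (β γ : Fin M →₀ ℕ) :
    weight η (β + γ) = weight η β + weight η γ := by
  simp [weight, add_nsmul, Finset.sum_add_distrib]

theorem weight_single_one (η : Fin M → WithTop ℝ) (i : Fin M) :
    weight η (Finsupp.single i 1) = η i := by
  simp [weight, Finsupp.single_apply]

theorem le_polyOrd_iff {p : WithTop ℝ} {f : MvPolynomial (Fin M) (S ω K)} :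
    p ≤ polyOrd η f ↔ ∀ β, p ≤ ord (f.coeff β) + weight η β := by
  refine Finset.le_inf_iff.trans (forall_congr' fun β => ⟨fun h => ?_, fun h _ => h⟩)
  by_cases hβ : β ∈ f.support
  · exact h hβ
  · rw [notMem_support_iff.mp hβ, ord_zero, WithTop.top_add]
    exact le_top

/-- The part of weighted order `p` of a polynomial. Unlike the initial part, which it is when `p` is
the order of the polynomial (`initPart_eq_levelPart`), it is additive in the polynomial. -/
noncomputable def levelPart (η : Fin M → WithTop ℝ) (p : ℝ) (f : MvPolynomial (Fin M) (S ω K)) :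
    MvPolynomial (Fin M) (S ω K) :=
  ∑ β ∈ f.support, monomial β (termsAt (weight η β) p (f.coeff β))

theorem coeff_levelPart (p : ℝ) (f : MvPolynomial (Fin M) (S ω K)) (β : Fin M →₀ ℕ) :
    (levelPart η p f).coeff β = termsAt (weight η β) p (f.coeff β) := by
  classical
  rw [levelPart, coeff_sum]
  simp only [coeff_monomial, Finset.sum_ite_eq', ite_eq_left_iff, notMem_support_iff]
  intro h
  rw [h, map_zero]

theorem levelPart_sub (p : ℝ) (f g : MvPolynomial (Fin M) (S ω K)) :
    levelPart η p (f - g) = levelPart η p f - levelPart η p g := by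
  ext1 β
  simp only [coeff_levelPart, coeff_sub, map_sub]

theorem levelPart_monomial (p : ℝ) (β : Fin M →₀ ℕ) (a : S ω K) :
    levelPart η p (monomial β a) = monomial β (termsAt (weight η β) p a) := by
  classical
  ext1 γ
  rw [coeff_levelPart, coeff_monomial, coeff_monomial]
  split_ifs with h
  · rw [h]
  · rw [map_zero]

theorem le_polyOrd_monomial {p : WithTop ℝ} {β : Fin M →₀ ℕ} {a : S ω K}
    (h : p ≤ ord a + weight η β) : p ≤ polyOrd η (monomial β a) := by
  classical
  refine le_polyOrd_iff.mpr fun γ => ?_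
  rw [coeff_monomial]
  split_ifs with hγ
  · rwa [← hγ]
  · rw [ord_zero, WithTop.top_add]
    exact le_top

variable [Fact (LinearIndependent ℚ ω)]

theorem le_polyOrd_sub {p : WithTop ℝ} {f g : MvPolynomial (Fin M) (S ω K)} (hf : p ≤ polyOrd η f)
    (hg : p ≤ polyOrd η g) : p ≤ polyOrd η (f - g) := by
  refine le_polyOrd_iff.mpr fun β => ?_
  refine (le_min (le_polyOrd_iff.mp hf β) (le_polyOrd_iff.mp hg β)).trans ?_
  rw [min_add_add_right, coeff_sub]
  exact add_le_add_left (ordValuation.map_sub _ _) _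

theorem polyOrd_add_le_polyOrd_mul (f g : MvPolynomial (Fin M) (S ω K)) :
    polyOrd η f + polyOrd η g ≤ polyOrd η (f * g) := by
  classical
  refine le_polyOrd_iff.mpr fun δ => ?_
  rw [coeff_mul]
  refine Finset.sum_induction _ (fun a => polyOrd η f + polyOrd η g ≤ ord a + weight η δ)
    (fun a b ha hb => ?_) ?_ fun x hx => ?_
  · refine (le_min ha hb).trans ?_
    rw [min_add_add_right]
    exact add_le_add_left (ordValuation.map_add a b) _
  · rw [ord_zero, WithTop.top_add]
    exact le_top
  · rw [← Finset.HasAntidiagonal.mem_antidiagonal.mp hx, weight_add, ord_mul, add_add_add_comm]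
    exact add_le_add (le_polyOrd_iff.mp le_rfl _) (le_polyOrd_iff.mp le_rfl _)

theorem levelPart_mul {p q : ℝ} {f g : MvPolynomial (Fin M) (S ω K)} (hf : p ≤ polyOrd η f)
    (hg : q ≤ polyOrd η g) : levelPart η (p + q) (f * g) = levelPart η p f * levelPart η q g := by
  classical
  ext1 δ
  rw [coeff_levelPart, coeff_mul, coeff_mul, map_sum]
  refine Finset.sum_congr rfl fun x hx => ?_
  rw [← Finset.HasAntidiagonal.mem_antidiagonal.mp hx, weight_add, coeff_levelPart, coeff_levelPart]
  exact termsAt_mul (le_polyOrd_iff.mp hf _) (le_polyOrd_iff.mp hg _)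

theorem initPart_eq_levelPart {p : ℝ} {f : MvPolynomial (Fin M) (S ω K)} (hf : polyOrd η f = p) :
    initPart η f = levelPart η p f := by
  classical
  rw [initPart, if_neg (hf.trans_ne WithTop.coe_ne_top), levelPart, Finset.sum_filter]
  refine Finset.sum_congr rfl fun β _ => ?_
  split_ifs with h
  · rw [termsAt_of_eq (h.trans hf)]
  · rw [termsAt_of_lt, map_zero]
    exact hf ▸ lt_of_le_of_ne (le_polyOrd_iff.mp le_rfl β) (Ne.symm h)

theorem polyOrd_eq_of_levelPart_ne_zero {p : ℝ} {f : MvPolynomial (Fin M) (S ω K)}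
    (hf : p ≤ polyOrd η f) (hne : levelPart η p f ≠ 0) : polyOrd η f = p := by
  obtain ⟨β, hβ⟩ := ne_zero_iff.mp hne
  rw [coeff_levelPart] at hβ
  refine le_antisymm ((le_polyOrd_iff.mp le_rfl β).trans ?_) hf
  exact not_lt.mp fun hlt => hβ (termsAt_of_lt hlt)

theorem weight_ord (ψ : Fin M → S ω K) (β : Fin M →₀ ℕ) :
    weight (fun i => ord (ψ i)) β = ord (∏ i, ψ i ^ β i) := by
  classical
  rw [weight]
  induction (Finset.univ : Finset (Fin M)) using Finset.induction_on with
  | empty => rw [Finset.sum_empty, Finset.prod_empty, ord_one]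
  | insert i s hi ih =>
    rw [Finset.sum_insert hi, Finset.prod_insert hi, ord_mul, ih]
    exact congrArg (· + _) (ordValuation.map_pow (ψ i) (β i)).symm

theorem eval_firstTerm_levelPart {ψ : Fin M → S ω K} {p : ℝ} {f : MvPolynomial (Fin M) (S ω K)}
    (hf : p ≤ polyOrd (fun i => ord (ψ i)) f) :
    eval (fun i => firstTerm (ψ i)) (levelPart (fun i => ord (ψ i)) p f)
      = termsAt 0 p (eval ψ f) := by
  rw [levelPart, map_sum, eval_eq' ψ f, map_sum]
  refine Finset.sum_congr rfl fun β _ => ?_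
  have hfirst : ∏ i, firstTerm (ψ i) ^ β i = firstTerm (∏ i, ψ i ^ β i) :=
    (Finset.prod_congr rfl fun i _ => (firstTermHom.map_pow (ψ i) (β i)).symm).trans
      (map_prod firstTermHom (fun i => ψ i ^ β i) Finset.univ).symm
  rw [eval_monomial, Finsupp.prod_fintype _ _ fun i => pow_zero _, hfirst, weight_ord]
  refine termsAt_ord_mul_firstTerm ?_
  rw [← weight_ord]
  exact le_polyOrd_iff.mp hf β

end LevelPart

section InitialIdeal

open MvPolynomial

variable {N M : ℕ} {ω : Fin N → ℝ} [Fact (LinearIndependent ℚ ω)] {K : Type*} [Field K]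
  {η : Fin M → WithTop ℝ}

/-- The polynomials with `η`-initial part non-vanishing at `φ`. A witness `p` for the membership is
necessarily the order of the polynomial, and `levelPart` is then its initial part. -/
noncomputable def nonvanishingInit (η : Fin M → WithTop ℝ) (φ : Fin M → S ω K) :
    Submonoid (MvPolynomial (Fin M) (S ω K)) where
  carrier := {f | ∃ p : ℝ, p ≤ polyOrd η f ∧ eval φ (levelPart η p f) ≠ 0}
  one_mem' := by
    have hord : ((0 : ℝ) : WithTop ℝ) = ord (1 : S ω K) + weight η 0 := by
      rw [ord_one, weight_zero, add_zero, WithTop.coe_zero]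
    refine ⟨0, le_polyOrd_monomial hord.le, ?_⟩
    change eval φ (levelPart η 0 (monomial 0 1)) ≠ 0
    rw [levelPart_monomial, termsAt_of_eq hord.symm, firstTerm_one, ← one_def, map_one]
    exact one_ne_zero
  mul_mem' := by
    rintro f g ⟨p, hp, hf⟩ ⟨q, hq, hg⟩
    refine ⟨p + q, (add_le_add hp hq).trans (polyOrd_add_le_polyOrd_mul f g), ?_⟩
    rw [levelPart_mul hp hq, map_mul]
    exact mul_ne_zero hf hg

theorem eval_initPart_ne_zero {φ : Fin M → S ω K} {f : MvPolynomial (Fin M) (S ω K)}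
    (hf : f ∈ nonvanishingInit η φ) : eval φ (initPart η f) ≠ 0 := by
  obtain ⟨p, hp, hne⟩ := hf
  rwa [initPart_eq_levelPart (polyOrd_eq_of_levelPart_ne_zero hp (ne_zero_of_map hne))]

theorem le_polyOrd_X_sub_C {p : WithTop ℝ} {i : Fin M} {a : S ω K} (hi : p ≤ η i) (ha : p ≤ ord a) :
    p ≤ polyOrd η (X i - C a) := by
  refine le_polyOrd_sub (le_polyOrd_monomial ?_) (le_polyOrd_monomial ?_)
  · rwa [ord_one, weight_single_one, zero_add]
  · rwa [weight_zero, add_zero]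

theorem eval_levelPart_X_sub_C (φ : Fin M → S ω K) (p : ℝ) (i : Fin M) (a : S ω K) :
    eval φ (levelPart η p (X i - C a)) = termsAt (η i) p 1 * φ i - termsAt 0 p a := by
  rw [X, C_apply, levelPart_sub, levelPart_monomial, levelPart_monomial, weight_single_one,
    weight_zero, map_sub, eval_monomial, eval_monomial, Finsupp.prod_zero_index, mul_one,
    Finsupp.prod_single_index (h := fun n e => φ n ^ e) (pow_zero _), pow_one]

/-- The initial part of `X i - C a` takes the value `φ i`, `-firstTerm a` or `φ i - firstTerm a` at
`φ`, according to which of `η i` and `ord a` is smaller. -/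
theorem X_sub_C_mem_nonvanishingInit {φ : Fin M → S ω K} (hφ : φ ∈ torus ω K η) {i : Fin M}
    {a : S ω K} (h : ¬(ord a = η i ∧ firstTerm a = φ i)) :
    X i - C a ∈ nonvanishingInit η φ := by
  have mem_of_value {p : ℝ} (hi : p ≤ η i) (ha : p ≤ ord a)
      (hne : termsAt (η i) p 1 * φ i - termsAt 0 p a ≠ 0) : X i - C a ∈ nonvanishingInit η φ :=
    ⟨p, le_polyOrd_X_sub_C hi ha, by rwa [eval_levelPart_X_sub_C]⟩
  rcases lt_trichotomy (ord a) (η i) with hlt | heq | hlt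
  · obtain ⟨p, hp⟩ := WithTop.ne_top_iff_exists.mp hlt.ne_top
    refine mem_of_value (hp.trans_le hlt.le) hp.le ?_
    rw [termsAt_of_lt (by rwa [hp, ord_one, zero_add]), zero_mul, zero_sub,
      termsAt_of_eq (by rw [hp, add_zero])]
    exact neg_ne_zero.mpr fun h => hlt.ne_top (ord_eq_top_iff.mpr (firstTerm_eq_zero_iff.mp h))
  · have hne : firstTerm a ≠ φ i := fun h' => h ⟨heq, h'⟩
    have htop : η i ≠ ⊤ := fun hi => hne <| by
      rw [hφ.2 i hi, firstTerm_eq_zero_iff, ← ord_eq_top_iff, heq, hi]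
    obtain ⟨p, hp⟩ := WithTop.ne_top_iff_exists.mp htop
    refine mem_of_value hp.le (hp.trans heq.symm).le ?_
    rw [termsAt_of_eq (by rw [ord_one, zero_add, hp]), firstTerm_one, one_mul,
      termsAt_of_eq (by rw [add_zero, heq, hp])]
    exact sub_ne_zero.mpr hne.symm
  · obtain ⟨p, hp⟩ := WithTop.ne_top_iff_exists.mp hlt.ne_top
    refine mem_of_value hp.le (hp.trans_le hlt.le) ?_
    rw [termsAt_of_eq (by rw [ord_one, zero_add, hp]), firstTerm_one, one_mul,
      termsAt_of_lt (by rwa [hp, add_zero]), sub_zero]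
    exact hφ.1 i hlt.ne_top

theorem exists_mem_zeroes_of_mem_zeroes_initIdeal [IsAlgClosed K] [CharZero K]
    {I : Ideal (MvPolynomial (Fin M) (S ω K))} (hI : (zeroes I).Finite) {φ : Fin M → S ω K}
    (hφ : φ ∈ torus ω K η) (hzero : φ ∈ zeroes (initIdeal η I)) :
    ∃ ψ ∈ zeroes I, ∀ i, ord (ψ i) = η i ∧ firstTerm (ψ i) = φ i := by
  by_contra! hnone
  obtain ⟨f, hf, hfI⟩ := exists_mem_ideal_of_finite_zeroLocus (I := I) hI
    (T := nonvanishingInit η φ) fun ψ hψ => by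
      obtain ⟨i, hi⟩ := hnone ψ hψ
      exact ⟨X i - C (ψ i), X_sub_C_mem_nonvanishingInit hφ (not_and.mpr hi), by simp⟩
  exact eval_initPart_ne_zero hf (hzero _ (Ideal.subset_span (Or.inl ⟨f, hfI, rfl⟩)))

theorem firstTerm_mem_zeroes_initIdeal {I : Ideal (MvPolynomial (Fin M) (S ω K))}
    {ψ : Fin M → S ω K} (hψ : ψ ∈ zeroes I) :
    (fun i => firstTerm (ψ i)) ∈ zeroes (initIdeal (fun i => ord (ψ i)) I) := by
  suffices initIdeal (fun i => ord (ψ i)) I ≤ RingHom.ker (eval fun i => firstTerm (ψ i)) from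
    fun f hf => this hf
  refine Ideal.span_le.mpr ?_
  rintro _ (⟨f, hf, rfl⟩ | ⟨i, hi, rfl⟩)
  · cases hp : polyOrd (fun i => ord (ψ i)) f with
    | top => rw [initPart, if_pos hp]; exact Ideal.zero_mem _
    | coe p =>
      rw [initPart_eq_levelPart hp, SetLike.mem_coe, RingHom.mem_ker,
        eval_firstTerm_levelPart hp.ge, hψ f hf, map_zero]
  · rw [SetLike.mem_coe, RingHom.mem_ker, eval_X, firstTerm_eq_zero_iff]
    exact ord_eq_top_iff.mp hi

end InitialIdeal

end OmegaPuiseux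

theorem mainTheorem4 {K : Type*} [Field K] [IsAlgClosed K] [CharZero K] {N M : ℕ}
    (ω : Fin N → ℝ) (hω : LinearIndependent ℚ ω)
    (I : Ideal (MvPolynomial (Fin M) (OmegaPuiseux.S ω K)))
    (hI : (OmegaPuiseux.zeroes I).Finite)
    (η : Fin M → WithTop ℝ)
    (φ : Fin M → OmegaPuiseux.S ω K) (hφ : φ ∈ OmegaPuiseux.torus ω K η) :
    φ ∈ OmegaPuiseux.zeroes (OmegaPuiseux.initIdeal η I) ↔
      (∀ i, OmegaPuiseux.ord (φ i) = η i) ∧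
        ∃ ψ ∈ OmegaPuiseux.zeroes I, ∀ i, OmegaPuiseux.firstTerm (ψ i) = φ i := by
  have := Fact.mk hω
  constructor
  · intro hzero
    obtain ⟨ψ, hψ, hψφ⟩ := OmegaPuiseux.exists_mem_zeroes_of_mem_zeroes_initIdeal hI hφ hzero
    refine ⟨fun i => ?_, ψ, hψ, fun i => (hψφ i).2⟩
    rw [← (hψφ i).2, OmegaPuiseux.ord_firstTerm, (hψφ i).1]
  · rintro ⟨hord, ψ, hψ, hψφ⟩
    obtain rfl : (fun i => OmegaPuiseux.firstTerm (ψ i)) = φ := funext hψφ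
    obtain rfl : (fun i => OmegaPuiseux.ord (ψ i)) = η :=
      funext fun i => (OmegaPuiseux.ord_firstTerm (ψ i)).symm.trans (hord i)
    exact OmegaPuiseux.firstTerm_mem_zeroes_initIdeal hψ
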